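/- **Setting.** Let $\sigma$ be a finite relational signature and $[n]=\{1,\dots,n\}$. The formulas of *conditional probability logic* $CPL(\sigma)$ are built from atomic formulas (including equalities and the constant $\top$) by $\neg,\wedge,\vee,\to,\leftrightarrow,\exists$ and, for real $r\ge 0$ and a sequence $\bar y$ of distinct variables, which become bound, $$\big(r+\|\varphi\mid\psi\|_{\bar y}\ \ge\ \|\theta\mid\tau\|_{\bar y}\big)\quad\text{and}\quad \big(\|\varphi\mid\psi\|_{\bar y}\ \ge\ \|\theta\mid\tau\|_{\bar y}+r\big).$$ Here $\|\varphi\mid\psi\|_{\bar y}$ is, in a finite structure and for given values of the other variables, the number of $\bar y$ satisfying $\varphi\wedge\psi$ divided by the number of $\bar y$ satisfying $\psi$; the two formulas are false if no $\bar y$ satisfies $\psi$ or no $\bar y$ satisfies $\tau$. The quantifier rank $\mathrm{qr}$ is $0$ for atomic formulas, the maximum over the parts for connectives, increases by $1$ for $\exists x$, and is the maximum over $\varphi,\psi,\theta,\tau$ plus $|\bar y|$ for the two new formulas. A formula is *quantifier-free* if it is built from atomic formulas by connectives only. Writing $\varphi(\bar x)$ means that $\bar x$ is a sequence of distinct variables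 containing all free variables of $\varphi$. A *lifted Bayesian network* $\mathfrak G$ for $\sigma$ consists of a directed acyclic graph with vertex set $\sigma$ (write $\mathrm{par}(R)$ for the set of parents of $R$) and, for each $R\in\sigma$, a number $\nu_R\ge 1$, *aggregation formulas* $\chi_{R,i}(\bar x)\in CPL(\mathrm{par}(R))$ for $1\le i\le \nu_R$, with $|\bar x|$ the arity of $R$, such that in every finite nonempty structure every tuple satisfies exactly one of $\chi_{R,1},\dots,\chi_{R,\nu_R}$, and numbers $\mu(R\mid\chi_{R,i})\in[0,1]$. It induces on the set $\mathbf W_n$ of $\sigma$-structures with domain $[n]$ the probability distribution $$\mathbb P_n(\mathcal A)=\prod_{R\in\sigma}\ \prod_{i=1}^{\nu_R}\ \prod_{\bar a\,:\,\mathcal A\models\chi_{R,i}(\bar a)}\lambda(\mathcal A,R,i,\bar a),\qquad \lambda(\mathcal A,R,i,\bar a)=\begin{cases}\mu(R\mid\chi_{R,i})&\text{if }\mathcal A\models R(\bar a),\\ 1-\mu(R\mid\chi_{R,i})&\text{otherwise.}\end{cases}$$ **Critical numbers.** Let $S\subseteq\sigma$ contain the parents of all its members; $S$ induces a subnetwork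 of $\mathfrak G$, whose distribution is the marginal of $\mathbb P_n$. A *complete atomic $S$-type* $p(\bar x)$ is a consistent set of atomic $S$-formulas in the variables $\bar x$ and negations of such, containing each atomic $S$-formula in $\bar x$ or its negation. Let $\mathsf P(p)$ be the limit, as $n\to\infty$, of the probability that $\bar a$ realizes $p$, uniformly over all $\bar a\in[n]^{|\bar x|}$ that satisfy the identities and non-identities in $p$ (if this limit exists). For complete atomic types $q(\bar x)\subseteq p(\bar x,\bar y)$ with $\mathsf P(q)\neq 0$ put $\mathsf P(p\mid q)=\mathsf P(p)/\mathsf P(q)$, and let $\dim_{\bar y}(p)$ be the largest value of $|\mathrm{rng}(\bar b)\setminus\mathrm{rng}(\bar a)|$ over realizations $(\bar a,\bar b)$ of $p$. A real number $\alpha$ is *$m$-critical with respect to $S$* if at least one of the following holds. (a) There are a complete atomic $S$-type $q(\bar x)$, where $\bar x$ may be empty, distinct complete atomic $S$-types $p_1(\bar x,\bar y),\dots,p_l(\bar x,\bar y)\supseteq q$ with $|\bar x\bar y|\le m$, and $1\le l'\le l$ such that $\alpha=\sum_{i\le l'}\mathsf P(p_i\mid q)\big/\sum_{i\le l}\mathsf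 P(p_i\mid q)$, where all these limits exist and the denominators are nonzero. (b) $\alpha=l'/l$ for integers $0\le l'\le l$, $l\geq 1$, where $l$ is at most the number of pairs $(p(x_1,\dots,x_{m'}),q(x_1,\dots,x_d))$ of complete atomic $S$-types with $d<m'\le m$, $q\subseteq p$ and $\dim_{(x_{d+1},\dots,x_{m'})}(p)=0$. A formula $\varphi(\bar x)\in CPL(S)$ is *noncritical with respect to $S$* if, with $m=|\bar x|+\mathrm{qr}(\varphi)$, every number $r$ occurring in a subformula $(r+\|\cdot\mid\cdot\|_{\bar y}\ge\|\cdot\mid\cdot\|_{\bar y})$ or $(\|\cdot\mid\cdot\|_{\bar y}\ge\|\cdot\mid\cdot\|_{\bar y}+r)$ of $\varphi$ satisfies $r\ne\alpha-\beta$ for all numbers $\alpha,\beta$ that are $m$-critical with respect to $S$. It is *noncritical* if it is noncritical with respect to $\sigma$. **Theorem (almost sure elimination of quantifiers for noncritical formulas).** Let $\sigma$ be a finite relational signature, $\mathfrak G$ a lifted Bayesian network for $\sigma$ and $\mathbb P_n$ the distribution it induces on $\mathbf W_n$. Suppose that every aggregation formula $\chi_{R,i}$ of $\mathfrak G$ is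 noncritical with respect to the set of proper ancestors of $R$ in the graph, that is, in the subnetwork on which $\chi_{R,i}$ is evaluated. If $\varphi(\bar x)\in CPL(\sigma)$ is noncritical, then there are a quantifier-free formula $\varphi^*(\bar x)\in CPL(\sigma)$ and a constant $c>0$, depending only on $\varphi(\bar x)$ and $\mathfrak G$, such that for all sufficiently large $n$ $$\mathbb P_n\big(\forall\bar x\,(\varphi(\bar x)\leftrightarrow\varphi^*(\bar x))\big)\ \ge\ 1-e^{-cn}.$$ -/

import Mathlib

open scoped NNReal

/-! A relational signature is a type `σ` of relation symbols with an arity function `ar : σ → ℕ`. -/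

/-- Structures with domain `A` over the relational signature `(σ, ar)`: an interpretation of every
relation symbol. -/
abbrev RelStr {σ : Type} (ar : σ → ℕ) (A : Type) : Type :=
  (R : σ) → (Fin (ar R) → A) → Prop

/-- Atomic formulas in the variables `x_0, …, x_{k-1}`, including equalities and the constant
formula `⊤`. -/
inductive Atom {σ : Type} (ar : σ → ℕ) (k : ℕ) : Type
  | top : Atom ar k
  | eq (i j : Fin k) : Atom ar k
  | rel (R : σ) (v : Fin (ar R) → Fin k) : Atom ar k

namespace Atom

variable {σ : Type} {ar : σ → ℕ}

/-- Truth of an atomic formula under an assignment. -/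
def Holds {A : Type} (M : RelStr ar A) {k : ℕ} (a : Fin k → A) : Atom ar k → Prop
  | top => True
  | eq i j => a i = a j
  | rel R v => M R (fun t => a (v t))

/-- The atomic formula contains no relation symbol outside `S`. -/
def Over (S : Set σ) {k : ℕ} : Atom ar k → Prop
  | top => True
  | eq _ _ => True
  | rel R _ => R ∈ S

/-- Renaming of variables. -/
def rename {k l : ℕ} (f : Fin k → Fin l) : Atom ar k → Atom ar l
  | top => top
  | eq i j => eq (f i) (f j)
  | rel R v => rel R (fun t => f (v t))

end Atom

/-- Formulas `φ(x_0, …, x_{k-1})` of conditional probability logic; the variables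
`x_0, …, x_{k-1}` may but need not occur. The quantifier `∃` binds the new variable `x_k`. In
`condL m r φ ψ θ τ`, which is `(r + ‖φ | ψ‖_y ≥ ‖θ | τ‖_y)`, and in `condR m r φ ψ θ τ`, which is
`(‖φ | ψ‖_y ≥ ‖θ | τ‖_y + r)`, the bound sequence `y` consists of the `m` new variables
`x_k, …, x_{k+m-1}`. -/
inductive CPL {σ : Type} (ar : σ → ℕ) : ℕ → Type
  | atom {k : ℕ} (t : Atom ar k) : CPL ar k
  | neg {k : ℕ} (φ : CPL ar k) : CPL ar k
  | and {k : ℕ} (φ ψ : CPL ar k) : CPL ar k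
  | or {k : ℕ} (φ ψ : CPL ar k) : CPL ar k
  | imp {k : ℕ} (φ ψ : CPL ar k) : CPL ar k
  | iff {k : ℕ} (φ ψ : CPL ar k) : CPL ar k
  | ex {k : ℕ} (φ : CPL ar (k + 1)) : CPL ar k
  | condL {k : ℕ} (m : ℕ) (r : ℝ≥0) (φ ψ θ τ : CPL ar (k + m)) : CPL ar k
  | condR {k : ℕ} (m : ℕ) (r : ℝ≥0) (φ ψ θ τ : CPL ar (k + m)) : CPL ar k

/-- The proportion `|X ∩ Y| / |Y|`. It is only used for finite `Y ≠ ∅`. -/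
noncomputable def proportion {B : Type} (X Y : Set B) : ℝ :=
  ((X ∩ Y).ncard : ℝ) / (Y.ncard : ℝ)

namespace CPL

variable {σ : Type} {ar : σ → ℕ}

/-- Semantics, meant for structures with a finite domain. A formula with conditional probability
quantifiers is false if one of the two conditions has no solution. -/
def Holds {A : Type} (M : RelStr ar A) : {k : ℕ} → CPL ar k → (Fin k → A) → Prop
  | _, atom t, a => t.Holds M a
  | _, neg φ, a => ¬ Holds M φ a
  | _, and φ ψ, a => Holds M φ a ∧ Holds M ψ a
  | _, or φ ψ, a => Holds M φ a ∨ Holds M ψ a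
  | _, imp φ ψ, a => Holds M φ a → Holds M ψ a
  | _, iff φ ψ, a => (Holds M φ a ↔ Holds M ψ a)
  | _, ex φ, a => ∃ b : A, Holds M φ (Fin.snoc a b)
  | _, condL m r φ ψ θ τ, a =>
      {b : Fin m → A | Holds M ψ (Fin.append a b)}.Nonempty ∧
      {b : Fin m → A | Holds M τ (Fin.append a b)}.Nonempty ∧
      (r : ℝ) + proportion {b : Fin m → A | Holds M φ (Fin.append a b)}
          {b : Fin m → A | Holds M ψ (Fin.append a b)} ≥
        proportion {b : Fin m → A | Holds M θ (Fin.append a b)}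
          {b : Fin m → A | Holds M τ (Fin.append a b)}
  | _, condR m r φ ψ θ τ, a =>
      {b : Fin m → A | Holds M ψ (Fin.append a b)}.Nonempty ∧
      {b : Fin m → A | Holds M τ (Fin.append a b)}.Nonempty ∧
      proportion {b : Fin m → A | Holds M φ (Fin.append a b)}
          {b : Fin m → A | Holds M ψ (Fin.append a b)} ≥
        proportion {b : Fin m → A | Holds M θ (Fin.append a b)}
          {b : Fin m → A | Holds M τ (Fin.append a b)} + (r : ℝ)

/-- The formula contains no relation symbol outside `S`. -/
def Over (S : Set σ) : {k : ℕ} → CPL ar k → Prop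
  | _, atom t => t.Over S
  | _, neg φ => Over S φ
  | _, and φ ψ => Over S φ ∧ Over S ψ
  | _, or φ ψ => Over S φ ∧ Over S ψ
  | _, imp φ ψ => Over S φ ∧ Over S ψ
  | _, iff φ ψ => Over S φ ∧ Over S ψ
  | _, ex φ => Over S φ
  | _, condL _ _ φ ψ θ τ => Over S φ ∧ Over S ψ ∧ Over S θ ∧ Over S τ
  | _, condR _ _ φ ψ θ τ => Over S φ ∧ Over S ψ ∧ Over S θ ∧ Over S τ

/-- The formula is built from atomic formulas by connectives only. -/
def QuantifierFree : {k : ℕ} → CPL ar k → Prop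
  | _, atom _ => True
  | _, neg φ => QuantifierFree φ
  | _, and φ ψ => QuantifierFree φ ∧ QuantifierFree ψ
  | _, or φ ψ => QuantifierFree φ ∧ QuantifierFree ψ
  | _, imp φ ψ => QuantifierFree φ ∧ QuantifierFree ψ
  | _, iff φ ψ => QuantifierFree φ ∧ QuantifierFree ψ
  | _, ex _ => False
  | _, condL _ _ _ _ _ _ => False
  | _, condR _ _ _ _ _ _ => False

/-- Quantifier rank. -/
def qr : {k : ℕ} → CPL ar k → ℕ
  | _, atom _ => 0
  | _, neg φ => qr φ
  | _, and φ ψ => max (qr φ) (qr ψ)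
  | _, or φ ψ => max (qr φ) (qr ψ)
  | _, imp φ ψ => max (qr φ) (qr ψ)
  | _, iff φ ψ => max (qr φ) (qr ψ)
  | _, ex φ => qr φ + 1
  | _, condL m _ φ ψ θ τ => max (max (qr φ) (qr ψ)) (max (qr θ) (qr τ)) + m
  | _, condR m _ φ ψ θ τ => max (max (qr φ) (qr ψ)) (max (qr θ) (qr τ)) + m

/-- The set of all numbers `r` that occur in a subformula `(r + ‖φ | ψ‖ ≥ ‖θ | τ‖)` or
`(‖φ | ψ‖ ≥ ‖θ | τ‖ + r)` of the given formula. -/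
def thresholds : {k : ℕ} → CPL ar k → Set ℝ
  | _, atom _ => ∅
  | _, neg φ => thresholds φ
  | _, and φ ψ => thresholds φ ∪ thresholds ψ
  | _, or φ ψ => thresholds φ ∪ thresholds ψ
  | _, imp φ ψ => thresholds φ ∪ thresholds ψ
  | _, iff φ ψ => thresholds φ ∪ thresholds ψ
  | _, ex φ => thresholds φ
  | _, condL _ r φ ψ θ τ =>
      {(r : ℝ)} ∪ thresholds φ ∪ thresholds ψ ∪ thresholds θ ∪ thresholds τ
  | _, condR _ r φ ψ θ τ =>
      {(r : ℝ)} ∪ thresholds φ ∪ thresholds ψ ∪ thresholds θ ∪ thresholds τ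

end CPL

/-! Atomic types -/

/-- Literals: `(t, true)` is the atomic formula `t`, and `(t, false)` is its negation. -/
abbrev Literal {σ : Type} (ar : σ → ℕ) (k : ℕ) : Type := Atom ar k × Bool

namespace Literal

variable {σ : Type} {ar : σ → ℕ}

/-- The set `p` of literals is realized by the tuple `a`. -/
def Realizes {A : Type} (M : RelStr ar A) {k : ℕ} (a : Fin k → A) (p : Set (Literal ar k)) : Prop :=
  ∀ t ∈ p, (t.1.Holds M a ↔ t.2 = true)

/-- `p` is a complete atomic type over the sub-signature `S` in `k` variables: a consistent set of
literals over `S` that contains each atomic formula over `S` or its negation. -/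
structure IsCompleteType (S : Set σ) {k : ℕ} (p : Set (Literal ar k)) : Prop where
  inSig : ∀ t ∈ p, t.1.Over S
  complete : ∀ t : Atom ar k, t.Over S → (t, true) ∈ p ∨ (t, false) ∈ p
  consistent : ∃ (A : Type) (_ : Nonempty A) (M : RelStr ar A) (a : Fin k → A), Realizes M a p

/-- The tuple `a` realizes the identity fragment of `p`. -/
def RealizesIdentities {A : Type} {k : ℕ} (a : Fin k → A) (p : Set (Literal ar k)) : Prop :=
  ∀ i j : Fin k, ((Atom.eq i j, true) ∈ p → a i = a j) ∧ ((Atom.eq i j, false) ∈ p → a i ≠ a j)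

/-- `q(x) ⊆ p(x, y)`, where `x` has length `d` and `y` has length `e`. -/
def Extends {d e : ℕ} (q : Set (Literal ar d)) (p : Set (Literal ar (d + e))) : Prop :=
  ∀ t ∈ q, (t.1.rename (Fin.castAdd e), t.2) ∈ p

/-- The `y`-dimension of `p(x, y)`, where `x` has length `d` and `y` has length `e`: the largest
number `N` such that some realization `(a, b)` of `p` has `|rng b \ rng a| ≥ N`. -/
noncomputable def dim {d e : ℕ} (p : Set (Literal ar (d + e))) : ℕ :=
  sSup {N : ℕ | ∃ (A : Type) (_ : Nonempty A) (M : RelStr ar A) (a : Fin d → A) (b : Fin e → A),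
    Realizes M (Fin.append a b) p ∧ N ≤ (Set.range b \ Set.range a).ncard}

/-- The number of pairs `(p(x_1, …, x_{d+e}), q(x_1, …, x_d))` of complete atomic types over `S`
with `e ≥ 1`, `d + e ≤ m` and `q ⊆ p` such that `p` has dimension `0` with respect to
`(x_{d+1}, …, x_{d+e})`. -/
noncomputable def numPairs (ar : σ → ℕ) (S : Set σ) (m : ℕ) : ℕ :=
  ∑ d ∈ Finset.range (m + 1), ∑ e ∈ Finset.Icc 1 (m - d),
    {pq : Set (Literal ar (d + e)) × Set (Literal ar d) |
      IsCompleteType S pq.1 ∧ IsCompleteType S pq.2 ∧ Extends pq.2 pq.1 ∧ dim pq.1 = 0}.ncard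

end Literal

/-- A lifted Bayesian network for the signature `(σ, ar)`. `edge Q R` says that `Q` is a parent of
`R`, and `Relation.TransGen edge Q R` that there is a directed path from `Q` to `R`. The
aggregation formulas of `R` use only parents of `R`; in every structure (with finite nonempty
domain, as the semantics requires) each tuple satisfies exactly one of them. -/
structure LiftedBN {σ : Type} (ar : σ → ℕ) where
  edge : σ → σ → Prop
  acyclic : ∀ R, ¬ Relation.TransGen edge R R
  ν : σ → ℕ
  ν_pos : ∀ R, 0 < ν R
  χ : (R : σ) → Fin (ν R) → CPL ar (ar R)
  χ_over : ∀ R i, (χ R i).Over {Q | edge Q R}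
  exhaustive : ∀ (R : σ) (A : Type) [Finite A] [Nonempty A] (M : RelStr ar A) (a : Fin (ar R) → A),
    ∃ i, (χ R i).Holds M a
  exclusive : ∀ (R : σ) (i j : Fin (ν R)), i ≠ j →
    ∀ (A : Type) [Finite A] [Nonempty A] (M : RelStr ar A),
      ¬ ∃ a : Fin (ar R) → A, (χ R i).Holds M a ∧ (χ R j).Holds M a
  μ : (R : σ) → Fin (ν R) → ℝ
  μ_mem : ∀ R i, μ R i ∈ Set.Icc (0 : ℝ) 1

namespace LiftedBN

variable {σ : Type} {ar : σ → ℕ}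

open Classical in
/-- The probability `P_n(M)` of the structure `M` with an `n`-element domain. Since the aggregation
formulas of `R` only use parents of `R`, the recursion that adds the symbols level by level along
the acyclic graph, multiplying in one step by the factors of the symbols of one level, unfolds to
this product over all symbols. -/
noncomputable def weight [Fintype σ] (G : LiftedBN ar) (n : ℕ) (M : RelStr ar (Fin n)) : ℝ :=
  ∏ R : σ, ∏ i : Fin (G.ν R), ∏ a : Fin (ar R) → Fin n with (G.χ R i).Holds M a,
    if M R a then G.μ R i else 1 - G.μ R i

open Classical in
/-- The probability `P_n(X)` of a set of structures with domain `Fin n`. -/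
noncomputable def prob [Fintype σ] (G : LiftedBN ar) (n : ℕ) (X : Set (RelStr ar (Fin n))) : ℝ :=
  ∑ M : RelStr ar (Fin n) with M ∈ X, G.weight n M

/-- `v` is the limit probability `P(p)` of the atomic type `p`: as `n → ∞`, the probability that
`a` realizes `p` tends to `v`, uniformly in the tuples `a` that realize the identity fragment. -/
def IsLimitProb [Fintype σ] (G : LiftedBN ar) {k : ℕ} (p : Set (Literal ar k)) (v : ℝ) : Prop :=
  ∀ ε : ℝ, 0 < ε → ∀ᶠ n : ℕ in Filter.atTop, ∀ a : Fin k → Fin n,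
    Literal.RealizesIdentities a p → |G.prob n {M | Literal.Realizes M a p} - v| ≤ ε

/-- First kind of `m`-critical numbers: quotients
`(∑_{i ≤ l'} P(p_i | q)) / (∑_{i ≤ l} P(p_i | q))`, where `P(p_i | q) = P(p_i) / P(q)`. All
denominators must be nonzero. -/
def CriticalA [Fintype σ] (G : LiftedBN ar) (S : Set σ) (m : ℕ) (α : ℝ) : Prop :=
  ∃ (d e : ℕ) (q : Set (Literal ar d)) (l l' : ℕ) (p : Fin l → Set (Literal ar (d + e)))
    (Pq : ℝ) (P : Fin l → ℝ),
    d + e ≤ m ∧ 1 ≤ l' ∧ l' ≤ l ∧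
    Literal.IsCompleteType S q ∧ (∀ i, Literal.IsCompleteType S (p i)) ∧
    Function.Injective p ∧ (∀ i, Literal.Extends q (p i)) ∧
    G.IsLimitProb q Pq ∧ (∀ i, G.IsLimitProb (p i) (P i)) ∧
    Pq ≠ 0 ∧ ∑ i, P i / Pq ≠ 0 ∧
    α = (∑ i : Fin l with i.val < l', P i / Pq) / ∑ i, P i / Pq

/-- Second kind of `m`-critical numbers: fractions `l' / l`. -/
def CriticalB (ar : σ → ℕ) (S : Set σ) (m : ℕ) (α : ℝ) : Prop :=
  ∃ l l' : ℕ, 1 ≤ l ∧ l' ≤ l ∧ l ≤ Literal.numPairs ar S m ∧ α = (l' : ℝ) / (l : ℝ)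

/-- The `m`-critical numbers of the subnetwork of `G` induced by a set `S` of symbols that contains
the parents of its members. (The distribution of the subnetwork is the marginal of that of `G`, so
the limit probabilities of its atomic types may be computed in `G`.) For `S = Set.univ` these are
the `m`-critical numbers of `G`. -/
def Critical [Fintype σ] (G : LiftedBN ar) (S : Set σ) (m : ℕ) (α : ℝ) : Prop :=
  G.CriticalA S m α ∨ CriticalB ar S m α

/-- The formula is noncritical with respect to the subnetwork of `G` induced by `S`. -/
def Noncritical [Fintype σ] (G : LiftedBN ar) (S : Set σ) {k : ℕ} (φ : CPL ar k) : Prop :=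
  ∀ r ∈ φ.thresholds, ∀ α β : ℝ, G.Critical S (k + φ.qr) α → G.Critical S (k + φ.qr) β →
    r ≠ α - β

/-- The proper ancestors of `R`; they induce the smallest subnetwork that contains the parents
of `R`. -/
def ancestors (G : LiftedBN ar) (R : σ) : Set σ := {Q | Relation.TransGen G.edge Q R}

end LiftedBN

/-! Sample the network with independent bits, one for each symbol `R`, tuple `a` and index `i`:
`R(a)` takes the value of the bit whose index is that of the aggregation formula true of `a`. By
acyclicity this recursion defines a random structure, and its law is that of the network
(`prob_eq`).

Suppose first that the index depends only on the atomic type of `a` over the ancestors of `R`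
(`localSelector`). Then "`a` realizes `p`" prescribes the values of fixed, pairwise distinct bits,
so its probability is a product `limP` that does not depend on `n`. For a realization `a` of a type,
the events that `(a, z)` realizes a given extension, for `z` outside `a`, involve disjoint sets of
bits. Hoeffding's inequality and a union bound over the `n^k` tuples show that, outside an event of
exponentially small probability, every realization has about the expected number of one-variable
extensions (`eventually_count_extensions`). Iterating, a realization of `q` has `(P p / P q + o(1))
n ^ dim` extensions to `p` (`Saturated.count`).

In a conditional proportion only the types of largest dimension survive in the limit, so it tends to
`0` or to a critical number of the first kind (`exists_tendsto_proportion`). A noncritical threshold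
therefore separates the two limits that are compared, and the truth of the comparison depends only
on the atomic type of the parameters. Induction on the formula eliminates all quantifiers
(`exists_determined_formula`).

The general case is an induction on the size of an ancestor-closed set of symbols
(`exists_determined_of_noncritical`): by the induction hypothesis the aggregation formulas are with
high probability properties of atomic types, hence the true structure coincides with one built by a
local selector, and the limit probabilities of the two agree. -/

open MeasureTheory ProbabilityTheory Filter

/-! ### Formulas over a sub-signature, and atomic types represented by positive diagrams -/

namespace Atom

variable {σ : Type} {ar : σ → ℕ}

lemma holds_rename {A : Type} (M : RelStr ar A) {k l : ℕ} (f : Fin k → Fin l) (a : Fin l → A)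
    (t : Atom ar k) : (t.rename f).Holds M a ↔ t.Holds M (a ∘ f) := by
  cases t <;> rfl

lemma over_rename (S : Set σ) {k l : ℕ} (f : Fin k → Fin l) (t : Atom ar k) :
    (t.rename f).Over S ↔ t.Over S := by
  cases t <;> rfl

lemma over_mono {S T : Set σ} (h : S ⊆ T) {k : ℕ} {t : Atom ar k} (ht : t.Over S) : t.Over T := by
  cases t with
  | top => trivial
  | eq i j => trivial
  | rel R v => exact h ht

lemma over_univ {k : ℕ} (t : Atom ar k) : t.Over Set.univ := by
  cases t <;> trivial

lemma holds_congr {A : Type} {M M' : RelStr ar A} {S : Set σ} (h : ∀ R ∈ S, M R = M' R) {k : ℕ}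
    {t : Atom ar k} (ht : t.Over S) (a : Fin k → A) : t.Holds M a ↔ t.Holds M' a := by
  cases t with
  | top => rfl
  | eq i j => rfl
  | rel R v => simp only [Holds, h R ht]

instance [Finite σ] (k : ℕ) : Finite (Atom ar k) := by
  let f : Atom ar k → Option ((Fin k × Fin k) ⊕ ((R : σ) × (Fin (ar R) → Fin k))) := fun t =>
    match t with
    | top => none
    | eq i j => some (Sum.inl (i, j))
    | rel R v => some (Sum.inr ⟨R, v⟩)
  refine Finite.of_injective f ?_
  intro t t' h
  cases t <;> cases t' <;> simp_all [f]

end Atom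

namespace CPL

variable {σ : Type} {ar : σ → ℕ}

lemma over_mono {S T : Set σ} (h : S ⊆ T) {k : ℕ} (φ : CPL ar k) (hφ : φ.Over S) : φ.Over T := by
  induction φ with
  | atom t => exact Atom.over_mono h hφ
  | neg φ ih => exact ih hφ
  | and φ ψ h1 h2 | or φ ψ h1 h2 | imp φ ψ h1 h2 | iff φ ψ h1 h2 => exact ⟨h1 hφ.1, h2 hφ.2⟩
  | ex φ ih => exact ih hφ
  | condL m r φ ψ θ τ h1 h2 h3 h4 | condR m r φ ψ θ τ h1 h2 h3 h4 =>
    exact ⟨h1 hφ.1, h2 hφ.2.1, h3 hφ.2.2.1, h4 hφ.2.2.2⟩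

lemma over_univ {k : ℕ} (φ : CPL ar k) : φ.Over Set.univ := by
  induction φ with
  | atom t => exact Atom.over_univ t
  | neg φ ih => exact ih
  | and φ ψ h1 h2 | or φ ψ h1 h2 | imp φ ψ h1 h2 | iff φ ψ h1 h2 => exact ⟨h1, h2⟩
  | ex φ ih => exact ih
  | condL m r φ ψ θ τ h1 h2 h3 h4 | condR m r φ ψ θ τ h1 h2 h3 h4 => exact ⟨h1, h2, h3, h4⟩

/-- The truth of a formula over `S` depends only on the interpretations of the symbols in `S`. -/
lemma holds_congr {A : Type} {M M' : RelStr ar A} {S : Set σ} (h : ∀ R ∈ S, M R = M' R) {k : ℕ}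
    (φ : CPL ar k) (hφ : φ.Over S) (a : Fin k → A) : φ.Holds M a ↔ φ.Holds M' a := by
  induction φ with
  | atom t => exact Atom.holds_congr h hφ a
  | neg φ ih => simp only [Holds, ih hφ a]
  | and φ ψ h1 h2 | or φ ψ h1 h2 | imp φ ψ h1 h2 | iff φ ψ h1 h2 =>
    simp only [Holds, h1 hφ.1 a, h2 hφ.2 a]
  | ex φ ih => simp only [Holds, fun b => ih hφ (Fin.snoc a b)]
  | condL m r φ ψ θ τ h1 h2 h3 h4 | condR m r φ ψ θ τ h1 h2 h3 h4 =>
    simp only [Holds, fun b => h1 hφ.1 (Fin.append a b), fun b => h2 hφ.2.1 (Fin.append a b),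
      fun b => h3 hφ.2.2.1 (Fin.append a b), fun b => h4 hφ.2.2.2 (Fin.append a b)]

end CPL

section Diagram

variable {σ : Type} {ar : σ → ℕ}

/-- The positive diagram over `S` of the tuple `a`: the atomic formulas over `S` true of `a`. It
represents the complete atomic `S`-type of `a`. -/
def diag (S : Set σ) {A : Type} (M : RelStr ar A) {k : ℕ} (a : Fin k → A) : Set (Atom ar k) :=
  {t | t.Over S ∧ t.Holds M a}

/-- Substitution of variables in a positive diagram. -/
def pull {k l : ℕ} (f : Fin k → Fin l) (p : Set (Atom ar l)) : Set (Atom ar k) :=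
  {t | t.rename f ∈ p}

/-- The set `p` is the positive diagram over `S` of some tuple. -/
def IsDiag (S : Set σ) {k : ℕ} (p : Set (Atom ar k)) : Prop :=
  ∃ (A : Type) (_ : Nonempty A) (M : RelStr ar A) (a : Fin k → A), p = diag S M a

lemma pull_diag (S : Set σ) {A : Type} (M : RelStr ar A) {k l : ℕ} (f : Fin k → Fin l)
    (a : Fin l → A) : pull f (diag S M a) = diag S M (a ∘ f) := by
  ext t
  simp only [pull, diag, Set.mem_ofPred_eq, Atom.over_rename, Atom.holds_rename]

lemma IsDiag.pull {S : Set σ} {k l : ℕ} {p : Set (Atom ar l)} (hp : IsDiag S p)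
    (f : Fin k → Fin l) : IsDiag S (pull f p) := by
  obtain ⟨A, hA, M, a, rfl⟩ := hp
  exact ⟨A, hA, M, a ∘ f, pull_diag S M f a⟩

lemma isDiag_diag (S : Set σ) {A : Type} [Nonempty A] (M : RelStr ar A) {k : ℕ} (a : Fin k → A) :
    IsDiag S (diag S M a) :=
  ⟨A, inferInstance, M, a, rfl⟩

lemma diag_inter_over {S T : Set σ} (h : T ⊆ S) {A : Type} (M : RelStr ar A) {k : ℕ}
    (a : Fin k → A) : diag S M a ∩ {t | t.Over T} = diag T M a := by
  ext t
  constructor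
  · rintro ⟨⟨_, h1⟩, h2⟩
    exact ⟨h2, h1⟩
  · rintro ⟨h1, h2⟩
    exact ⟨⟨Atom.over_mono h h1, h2⟩, h1⟩

lemma diag_congr {A : Type} {M M' : RelStr ar A} {S : Set σ} (h : ∀ R ∈ S, M R = M' R) {k : ℕ}
    (a : Fin k → A) : diag S M a = diag S M' a := by
  ext t
  exact and_congr_right fun ht => Atom.holds_congr h ht a

lemma eq_mem_diag {S : Set σ} {A : Type} {M : RelStr ar A} {k : ℕ} {a : Fin k → A} {i j : Fin k} :
    Atom.eq i j ∈ diag S M a ↔ a i = a j :=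
  ⟨fun h => h.2, fun h => ⟨trivial, h⟩⟩

lemma rel_mem_diag {S : Set σ} {A : Type} {M : RelStr ar A} {k : ℕ} {a : Fin k → A} {R : σ}
    (hR : R ∈ S) {v : Fin (ar R) → Fin k} : Atom.rel R v ∈ diag S M a ↔ M R (a ∘ v) :=
  ⟨fun h => h.2, fun h => ⟨hR, h⟩⟩

lemma atom_holds_iff_mem_diag {S : Set σ} {A : Type} {M : RelStr ar A} {k : ℕ} {a : Fin k → A}
    {t : Atom ar k} (ht : t.Over S) : t.Holds M a ↔ t ∈ diag S M a :=
  ⟨fun h => ⟨ht, h⟩, fun h => h.2⟩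

/-- A diagram is determined by the identities and the relational atoms in it. -/
lemma diag_eq_of {S : Set σ} {A : Type} {M : RelStr ar A} {k : ℕ} {a : Fin k → A}
    {p : Set (Atom ar k)} (hp : IsDiag S p) (h1 : ∀ i j, a i = a j ↔ Atom.eq i j ∈ p)
    (h2 : ∀ R ∈ S, ∀ v, M R (a ∘ v) ↔ Atom.rel R v ∈ p) : diag S M a = p := by
  obtain ⟨A', _, M', a', rfl⟩ := hp
  ext t
  cases t with
  | top => exact ⟨fun _ => ⟨trivial, trivial⟩, fun _ => ⟨trivial, trivial⟩⟩
  | eq i j => rw [eq_mem_diag, h1]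
  | rel R v =>
    by_cases hR : R ∈ S
    · rw [rel_mem_diag hR, h2 R hR]
    · exact ⟨fun h => absurd h.1 hR, fun h => absurd h.1 hR⟩

/-- The literals over `S` of the complete atomic type with positive part `p`. -/
def lits (S : Set σ) {k : ℕ} (p : Set (Atom ar k)) : Set (Literal ar k) :=
  {l | l.1.Over S ∧ (l.1 ∈ p ↔ l.2 = true)}

lemma realizes_lits {S : Set σ} {k : ℕ} {p : Set (Atom ar k)} (hp : IsDiag S p) {A : Type}
    (M : RelStr ar A) (a : Fin k → A) : Literal.Realizes M a (lits S p) ↔ diag S M a = p := by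
  constructor
  · intro h
    obtain ⟨A', _, M', a', rfl⟩ := hp
    ext t
    by_cases ht : t.Over S
    · by_cases hm : t ∈ diag S M' a'
      · have := h (t, true) ⟨ht, by simpa using hm⟩
        simp only [iff_true] at this
        exact ⟨fun _ => hm, fun _ => ⟨ht, this⟩⟩
      · have := h (t, false) ⟨ht, by simpa using hm⟩
        simp only [Bool.false_eq_true, iff_false] at this
        exact ⟨fun h' => absurd h'.2 this, fun h' => absurd h' hm⟩
    · exact ⟨fun h' => absurd h'.1 ht, fun h' => absurd h'.1 ht⟩
  · rintro rfl ⟨t, b⟩ ⟨ht, h⟩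
    rw [atom_holds_iff_mem_diag ht]
    exact h

lemma isCompleteType_lits {S : Set σ} {k : ℕ} {p : Set (Atom ar k)} (hp : IsDiag S p) :
    Literal.IsCompleteType S (lits S p) where
  inSig := fun _ ht => ht.1
  complete := fun t ht => by
    by_cases h : t ∈ p
    · exact Or.inl ⟨ht, by simpa using h⟩
    · exact Or.inr ⟨ht, by simpa using h⟩
  consistent := by
    obtain ⟨A, hA, M, a, h⟩ := hp
    exact ⟨A, hA, M, a, (realizes_lits ⟨A, hA, M, a, h⟩ M a).2 h.symm⟩

lemma extends_lits {S : Set σ} {d e : ℕ} {q : Set (Atom ar d)} {p : Set (Atom ar (d + e))}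
    (h : pull (Fin.castAdd e) p = q) : Literal.Extends (lits S q) (lits S p) := by
  rintro ⟨t, b⟩ ⟨h1, h2⟩
  subst h
  exact ⟨(Atom.over_rename S _ t).2 h1, h2⟩

lemma lits_injective {S : Set σ} {k : ℕ} {p p' : Set (Atom ar k)} (hp : IsDiag S p)
    (hp' : IsDiag S p') (h : lits S p = lits S p') : p = p' := by
  have hp2 := hp'
  obtain ⟨A, _, M, a, rfl⟩ := hp2
  have := (realizes_lits hp' M a).2 rfl
  rw [← h, realizes_lits hp] at this
  exact this.symm

lemma realizesIdentities_lits {S : Set σ} {k : ℕ} {p : Set (Atom ar k)} {A : Type} {a : Fin k → A} :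
    Literal.RealizesIdentities a (lits S p) ↔ ∀ i j, a i = a j ↔ Atom.eq i j ∈ p := by
  have h1 : ∀ i j, ((Atom.eq i j, true) : Literal ar k) ∈ lits S p ↔ Atom.eq i j ∈ p := fun i j =>
    ⟨fun h => h.2.2 rfl, fun h => ⟨trivial, by simpa using h⟩⟩
  have h2 : ∀ i j, ((Atom.eq i j, false) : Literal ar k) ∈ lits S p ↔ Atom.eq i j ∉ p := fun i j =>
    ⟨fun h h' => by simpa using h.2.1 h', fun h => ⟨trivial, by simpa using h⟩⟩
  unfold Literal.RealizesIdentities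
  refine forall_congr' fun i => forall_congr' fun j => ?_
  rw [h1, h2]
  tauto

/-- Every property of diagrams is expressed by a quantifier-free formula. -/
lemma exists_quantifierFree [Finite σ] {k : ℕ} (D : Set (Set (Atom ar k))) :
    ∃ φ : CPL ar k, φ.QuantifierFree ∧ ∀ (A : Type) (M : RelStr ar A) (a : Fin k → A),
      φ.Holds M a ↔ diag Set.univ M a ∈ D := by
  classical
  have key : ∀ p : Set (Atom ar k), ∃ φ : CPL ar k, φ.QuantifierFree ∧
      ∀ (A : Type) (M : RelStr ar A) (a : Fin k → A), φ.Holds M a ↔ diag Set.univ M a = p := by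
    -- Since `σ` is finite there are finitely many atoms in `k` variables: the conjunction of all
    -- literals of `p` pins the diagram down, and a finite disjunction of such conjunctions gives
    -- `D`.
    intro p
    have : ∀ s : Set (Atom ar k), s.Finite → ∃ φ : CPL ar k, φ.QuantifierFree ∧
        ∀ (A : Type) (M : RelStr ar A) (a : Fin k → A),
          φ.Holds M a ↔ ∀ t ∈ s, (t ∈ diag Set.univ M a ↔ t ∈ p) := by
      intro s hs
      induction s, hs using Set.Finite.induction_on with
      | empty => exact ⟨.atom .top, trivial, fun A M a => by simp [CPL.Holds, Atom.Holds]⟩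
      | @insert t s _ _ ih =>
        obtain ⟨φ, h1, h2⟩ := ih
        by_cases ht : t ∈ p
        · refine ⟨.and (.atom t) φ, ⟨trivial, h1⟩, fun A M a => ?_⟩
          simp [CPL.Holds, h2, ht, atom_holds_iff_mem_diag (Atom.over_univ t)]
        · refine ⟨.and (.neg (.atom t)) φ, ⟨trivial, h1⟩, fun A M a => ?_⟩
          simp [CPL.Holds, h2, ht, atom_holds_iff_mem_diag (Atom.over_univ t)]
    obtain ⟨φ, h1, h2⟩ := this Set.univ Set.finite_univ
    exact ⟨φ, h1, fun A M a => by rw [h2, Set.ext_iff]; simp⟩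
  induction D, D.toFinite using Set.Finite.induction_on with
  | empty => exact ⟨.neg (.atom .top), trivial, fun A M a => by simp [CPL.Holds, Atom.Holds]⟩
  | @insert p D _ _ ih =>
    obtain ⟨φ, h1, h2⟩ := ih
    obtain ⟨ψ, h3, h4⟩ := key p
    exact ⟨.or ψ φ, ⟨h3, h1⟩, fun A M a => by simp [CPL.Holds, h2, h4]⟩

end Diagram

/-! ### Independent bits and Hoeffding's inequality -/

/-- The Bernoulli measure on `Bool` with success probability `p`. -/
noncomputable def boolMeasure (p : ℝ) : Measure Bool :=
  ENNReal.ofReal p • Measure.dirac true + ENNReal.ofReal (1 - p) • Measure.dirac false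

lemma isProbabilityMeasure_boolMeasure {p : ℝ} (hp : p ∈ Set.Icc (0 : ℝ) 1) :
    IsProbabilityMeasure (boolMeasure p) := by
  refine ⟨?_⟩
  simp only [boolMeasure, Measure.coe_add, Measure.coe_smul, Pi.add_apply, Pi.smul_apply,
    measure_univ, smul_eq_mul, mul_one]
  rw [← ENNReal.ofReal_add hp.1 (by linarith [hp.2])]
  simp

open Classical in
/-- The probability that a Bernoulli variable with success probability `p` has truth value `b`. -/
noncomputable def boolWeight (p : ℝ) (b : Prop) : ℝ := if b then p else 1 - p

lemma boolWeight_nonneg {p : ℝ} (hp : p ∈ Set.Icc (0 : ℝ) 1) (b : Prop) : 0 ≤ boolWeight p b := by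
  unfold boolWeight
  split_ifs
  · exact hp.1
  · linarith [hp.2]

lemma boolWeight_le_one {p : ℝ} (hp : p ∈ Set.Icc (0 : ℝ) 1) (b : Prop) : boolWeight p b ≤ 1 := by
  unfold boolWeight
  split_ifs
  · exact hp.2
  · linarith [hp.1]

lemma boolMeasure_real {p : ℝ} (hp : p ∈ Set.Icc (0 : ℝ) 1) (b : Prop) :
    (boolMeasure p).real {x | x = true ↔ b} = boolWeight p b := by
  have h0 := hp.1
  have h1 : 0 ≤ 1 - p := by linarith [hp.2]
  by_cases hb : b <;>
  simp [boolWeight, boolMeasure, hb, measureReal_def, h0, h1]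

/-- The probability of prescribing the values of a family of distinct independent bits. -/
lemma pi_boolMeasure_real {ι J : Type} [Fintype ι] [Fintype J] {w : ι → ℝ}
    (hw : ∀ i, w i ∈ Set.Icc (0 : ℝ) 1) (f : J → ι) (hf : Function.Injective f) (b : J → Prop) :
    (Measure.pi fun i => boolMeasure (w i)).real {x | ∀ j, x (f j) = true ↔ b j} =
      ∏ j, boolWeight (w (f j)) (b j) := by
  classical
  have : ∀ i, IsProbabilityMeasure (boolMeasure (w i)) :=
    fun i => isProbabilityMeasure_boolMeasure (hw i)
  -- The event is a box, with the full side `Bool` at every coordinate outside the range of `f`.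
  have : {x : ι → Bool | ∀ j, x (f j) = true ↔ b j} =
      Set.pi Set.univ fun i => {y | ∀ j, f j = i → (y = true ↔ b j)} := by
    ext x
    simp only [Set.mem_ofPred_eq, Set.mem_pi, Set.mem_univ, true_imp_iff]
    exact ⟨fun h i j hj => hj ▸ h j, fun h j => h _ j rfl⟩
  rw [this, measureReal_def, Measure.pi_pi, ENNReal.toReal_prod]
  rw [← Finset.prod_subset (Finset.subset_univ (Finset.univ.image f)),
    Finset.prod_image (fun _ _ _ _ h => hf h)]
  · refine Finset.prod_congr rfl fun j _ => ?_
    rw [← boolMeasure_real (hw (f j)) (b j), measureReal_def]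
    congr 2
    ext y
    simp only [Set.mem_ofPred_eq]
    exact ⟨fun h => h j rfl, fun h j' hj' => (hf hj') ▸ h⟩
  · intro i _ hi
    have : {y : Bool | ∀ j, f j = i → (y = true ↔ b j)} = Set.univ := by
      refine Set.eq_univ_of_forall fun y j hj => ?_
      exact absurd (Finset.mem_image.2 ⟨j, Finset.mem_univ _, hj⟩) hi
    rw [this, measure_univ, ENNReal.toReal_one]

/-- Hoeffding's inequality for the number of independent events of equal probability that occur. -/
lemma hoeffding_count {Ω ι : Type} [MeasurableSpace Ω] [Fintype ι] (P : Measure Ω)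
    [IsProbabilityMeasure P] {E : ι → Set Ω} (hE : ∀ i, MeasurableSet (E i)) (h : iIndepSet E P)
    {p : ℝ} (hp : ∀ i, P.real (E i) = p) {N : ℝ} (hN : (Fintype.card ι : ℝ) ≤ N) (hN0 : 0 < N)
    {ε : ℝ} (hε : 0 ≤ ε) :
    P.real {ω | ε * N ≤ |({i | ω ∈ E i}.ncard : ℝ) - Fintype.card ι * p|} ≤
      2 * Real.exp (-(2 * ε ^ 2) * N) := by
  classical
  set X : ι → Ω → ℝ := fun i => (E i).indicator fun _ => 1 with hX
  have hXm : ∀ i, Measurable (X i) := fun i => measurable_const.indicator (hE i)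
  have hind : iIndepFun X P := h.iIndepFun_indicator
  have hint : ∀ i, ∫ ω, X i ω ∂P = p := fun i => by
    rw [← hp i, hX]
    simp [integral_indicator (hE i), measureReal_def]
  have hsub : ∀ i, HasSubgaussianMGF (fun ω => X i ω - p) (1 / 4) P := fun i => by
    have := hasSubgaussianMGF_of_mem_Icc (μ := P) (X := X i) (a := 0) (b := 1)
      (hXm i).aemeasurable (ae_of_all _ fun ω => by
        by_cases hω : ω ∈ E i <;> simp [hX, hω])
    rw [hint i] at this
    -- The sub-Gaussian parameter of a variable with values in `[0, 1]` is `((1 - 0) / 2) ^ 2 = 1 /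
    -- 4`.
    convert this using 1
    ext
    norm_num
  have hsub' : ∀ i, HasSubgaussianMGF (fun ω => -(X i ω - p)) (1 / 4) P := fun i => (hsub i).neg
  have hind1 : iIndepFun (fun i ω => X i ω - p) P :=
    hind.comp (fun _ x => x - p) fun _ => measurable_id.sub_const p
  have hind2 : iIndepFun (fun i ω => -(X i ω - p)) P :=
    hind.comp (fun _ x => -(x - p)) fun _ => (measurable_id.sub_const p).neg
  have hεN : 0 ≤ ε * N := mul_nonneg hε hN0.le
  have hb1 := HasSubgaussianMGF.measure_sum_ge_le_of_iIndepFun hind1 (s := Finset.univ)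
    (fun i _ => hsub i) hεN
  have hb2 := HasSubgaussianMGF.measure_sum_ge_le_of_iIndepFun hind2 (s := Finset.univ)
    (fun i _ => hsub' i) hεN
  have hcount : ∀ ω, ({i | ω ∈ E i}.ncard : ℝ) - Fintype.card ι * p = ∑ i, (X i ω - p) := by
    intro ω
    rw [Finset.sum_sub_distrib]
    simp only [Finset.sum_const, Finset.card_univ, nsmul_eq_mul]
    congr 1
    simp only [hX, Set.indicator_apply, Finset.sum_ite, Finset.sum_const_zero, add_zero,
      Finset.sum_const, nsmul_eq_mul, mul_one]
    rw [Set.ncard_eq_toFinset_card']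
    congr 2
    ext i
    simp
  -- Without events the total variance parameter is `0`, and the general bound degenerates by
  -- division by zero; but then the deviation is `0` as well.
  rcases isEmpty_or_nonempty ι with he | hne
  · rcases hε.eq_or_lt with rfl | hε'
    · refine (measureReal_le_one).trans ?_
      norm_num
    · have : {ω | ε * N ≤ |({i | ω ∈ E i}.ncard : ℝ) - Fintype.card ι * p|} = ∅ := by
        ext ω
        simp only [hcount, Finset.univ_eq_empty, Finset.sum_empty, abs_zero, Set.mem_ofPred_eq,
          Set.mem_empty_iff_false, iff_false, not_le]
        positivity
      rw [this]
      simp only [measureReal_empty]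
      positivity
  have hcard : (0 : ℝ) < Fintype.card ι := by exact_mod_cast Fintype.card_pos
  -- The exponent is `(ε N)² / (card / 2)`, which is at least `2 ε² N` because `card ≤ N`.
  have hexp : Real.exp (-(ε * N) ^ 2 / (2 * ((∑ _i : ι, (1 / 4 : ℝ≥0) : ℝ≥0) : ℝ))) ≤
      Real.exp (-(2 * ε ^ 2) * N) := by
    apply Real.exp_le_exp.2
    simp only [Finset.sum_const, Finset.card_univ, nsmul_eq_mul]
    push_cast
    rw [neg_div, neg_mul, neg_le_neg_iff, le_div_iff₀ (by positivity)]
    have : 0 ≤ ε ^ 2 * N * (N - Fintype.card ι) :=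
      mul_nonneg (by positivity) (by linarith)
    nlinarith
  have hsubset : {ω | ε * N ≤ |({i | ω ∈ E i}.ncard : ℝ) - Fintype.card ι * p|} ⊆
      {ω | ε * N ≤ ∑ i, (X i ω - p)} ∪ {ω | ε * N ≤ ∑ i, -(X i ω - p)} := by
    intro ω hω
    simp only [Set.mem_ofPred_eq, hcount] at hω
    rcases le_abs.1 hω with h | h
    · exact Or.inl h
    · right
      simp only [Set.mem_ofPred_eq]
      rwa [Finset.sum_neg_distrib]
  calc _ ≤ P.real _ := measureReal_mono hsubset
    _ ≤ _ := measureReal_union_le _ _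
    _ ≤ _ := by linarith [hb1.trans hexp, hb2.trans hexp]

/-! ### Exponentially likely events as a filter -/

/-- The filter of the sets whose complements have exponentially small probability. -/
def expSmallFilter (Ω : ℕ → Type) [∀ n, MeasurableSpace (Ω n)] (P : ∀ n, Measure (Ω n))
    [∀ n, IsProbabilityMeasure (P n)] : Filter (Σ n, Ω n) where
  sets := {X | ∃ c : ℝ, 0 < c ∧ ∀ᶠ n : ℕ in atTop,
    (P n).real {ω | (⟨n, ω⟩ : Σ n, Ω n) ∉ X} ≤ Real.exp (-c * n)}
  univ_sets := ⟨1, one_pos, Eventually.of_forall fun n => by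
    simp only [Set.mem_univ, not_true_eq_false]
    rw [show {_ω : Ω n | False} = ∅ from rfl, measureReal_empty]
    positivity⟩
  sets_of_superset := by
    rintro X Y ⟨c, hc, h⟩ hXY
    refine ⟨c, hc, h.mono fun n hn => le_trans (measureReal_mono ?_) hn⟩
    exact fun ω hω hX => hω (hXY hX)
  inter_sets := by
    rintro X Y ⟨c, hc, h⟩ ⟨c', hc', h'⟩
    -- Half of the smaller rate is given up to absorb the factor `2` of the union bound for large
    -- `n`.
    refine ⟨min c c' / 2, by positivity, ?_⟩
    have hlarge : ∀ᶠ n : ℕ in atTop, Real.log 2 / (min c c' / 2) ≤ n :=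
      tendsto_natCast_atTop_atTop.eventually_ge_atTop _
    filter_upwards [h, h', hlarge] with n hn hn' hl
    have hm : 0 < min c c' := lt_min hc hc'
    rw [div_le_iff₀ (by positivity)] at hl
    have h2 : (2 : ℝ) ≤ Real.exp (n * (min c c' / 2)) := by
      rw [← Real.log_le_iff_le_exp (by norm_num)]
      exact hl
    have hsub : {ω | (⟨n, ω⟩ : Σ n, Ω n) ∉ X ∩ Y} ⊆
        {ω | (⟨n, ω⟩ : Σ n, Ω n) ∉ X} ∪ {ω | (⟨n, ω⟩ : Σ n, Ω n) ∉ Y} := by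
      intro ω hω
      by_contra hcon
      simp only [Set.mem_union, Set.mem_ofPred_eq, not_or, not_not] at hcon
      exact hω hcon
    have hn0 : (0 : ℝ) ≤ n := Nat.cast_nonneg n
    have e1 : Real.exp (-c * n) ≤ Real.exp (-(min c c') * n) := by
      apply Real.exp_le_exp.2
      nlinarith [min_le_left c c']
    have e2 : Real.exp (-c' * n) ≤ Real.exp (-(min c c') * n) := by
      apply Real.exp_le_exp.2
      nlinarith [min_le_right c c']
    have e3 : Real.exp (-(min c c' / 2) * n) =
        Real.exp (-(min c c') * n) * Real.exp (n * (min c c' / 2)) := by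
      rw [← Real.exp_add]
      congr 1
      ring
    calc _ ≤ _ := measureReal_mono hsub
      _ ≤ _ := measureReal_union_le _ _
      _ ≤ Real.exp (-(min c c') * n) * 2 := by linarith
      _ ≤ _ := by
        rw [e3]
        exact mul_le_mul_of_nonneg_left h2 (Real.exp_pos _).le

section ExpSmall

variable {Ω : ℕ → Type} [∀ n, MeasurableSpace (Ω n)] {P : ∀ n, Measure (Ω n)}
  [∀ n, IsProbabilityMeasure (P n)]

lemma eventually_expSmallFilter {Q : (Σ n, Ω n) → Prop} :
    (∀ᶠ x in expSmallFilter Ω P, Q x) ↔ ∃ c : ℝ, 0 < c ∧ ∀ᶠ n : ℕ in atTop,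
      (P n).real {ω | ¬ Q ⟨n, ω⟩} ≤ Real.exp (-c * n) :=
  Iff.rfl

lemma tendsto_fst_expSmallFilter : Tendsto Sigma.fst (expSmallFilter Ω P) atTop := by
  rw [tendsto_atTop]
  intro N
  rw [eventually_expSmallFilter]
  refine ⟨1, one_pos, (eventually_ge_atTop N).mono fun n hn => ?_⟩
  simp only [hn, not_true_eq_false]
  rw [show {_ω : Ω n | False} = ∅ from rfl, measureReal_empty]
  positivity

/-- A union bound over polynomially many exponentially small events. -/
lemma eventually_expSmallFilter_forall_tuple {k : ℕ} {Q : (n : ℕ) → Ω n → (Fin k → Fin n) → Prop}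
    {C c : ℝ} (hc : 0 < c)
    (h : ∀ᶠ n : ℕ in atTop, ∀ a, (P n).real {ω | ¬ Q n ω a} ≤ C * Real.exp (-c * n)) :
    ∀ᶠ x in expSmallFilter Ω P, ∀ a, Q x.1 x.2 a := by
  rw [eventually_expSmallFilter]
  -- Half of the rate pays for the factor `C * n ^ k` of the union bound.
  refine ⟨c / 2, by positivity, ?_⟩
  have hlim : Tendsto (fun n : ℕ => C * ((n : ℝ) ^ k * Real.exp (-(c / 2) * n))) atTop (nhds 0) := by
    have h0 : Tendsto (fun x : ℝ => x ^ k * Real.exp (-(c / 2) * x)) atTop (nhds 0) := by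
      simpa using tendsto_rpow_mul_exp_neg_mul_atTop_nhds_zero k (c / 2) (by positivity)
    simpa using (h0.comp tendsto_natCast_atTop_atTop).const_mul C
  filter_upwards [h, hlim.eventually_le_const one_pos] with n hn hl
  have hset : {ω | ¬ ∀ a, Q n ω a} = ⋃ a, {ω | ¬ Q n ω a} := by
    ext ω
    simp
  rw [hset]
  calc _ ≤ ∑ a, (P n).real {ω | ¬ Q n ω a} := measureReal_iUnion_fintype_le _
    _ ≤ ∑ _a : Fin k → Fin n, C * Real.exp (-c * n) := Finset.sum_le_sum fun a _ => hn a
    _ = C * ((n : ℝ) ^ k * Real.exp (-(c / 2) * n)) * Real.exp (-(c / 2) * n) := by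
      rw [Finset.sum_const, nsmul_eq_mul, Finset.card_univ, Fintype.card_fun, Fintype.card_fin,
        Fintype.card_fin, show -c * (n : ℝ) = -(c / 2) * n + -(c / 2) * n by ring, Real.exp_add]
      push_cast
      ring
    _ ≤ 1 * Real.exp (-(c / 2) * n) := mul_le_mul_of_nonneg_right hl (Real.exp_pos _).le
    _ = _ := one_mul _

end ExpSmall

/-! ### Sampling the network with independent bits -/

namespace LiftedBN

variable {σ : Type} {ar : σ → ℕ} (G : LiftedBN ar)

/-- There is one random bit for every tuple and every possible choice of an aggregation formula. -/
abbrev Coord (n : ℕ) : Type := (R : σ) × (Fin (ar R) → Fin n) × Fin (G.ν R)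

/-- Values of all the random bits. -/
abbrev Bits (n : ℕ) : Type := G.Coord n → Bool

/-- The distribution of the random bits. -/
noncomputable def bitMeasure [Fintype σ] (n : ℕ) : Measure (G.Bits n) :=
  Measure.pi fun x => boolMeasure (G.μ x.1 x.2.2)

instance [Fintype σ] (n : ℕ) : IsProbabilityMeasure (G.bitMeasure n) := by
  have : ∀ x : G.Coord n, IsProbabilityMeasure (boolMeasure (G.μ x.1 x.2.2)) :=
    fun x => isProbabilityMeasure_boolMeasure (G.μ_mem _ _)
  unfold bitMeasure
  infer_instance

lemma bitMeasure_real [Fintype σ] {n : ℕ} {J : Type} [Fintype J] (f : J → G.Coord n)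
    (hf : Function.Injective f) (b : J → Prop) :
    (G.bitMeasure n).real {x | ∀ j, x (f j) = true ↔ b j} =
      ∏ j, boolWeight (G.μ (f j).1 (f j).2.2) (b j) :=
  pi_boolMeasure_real (w := fun x : G.Coord n => G.μ x.1 x.2.2) (fun x => G.μ_mem x.1 x.2.2) f hf b

lemma ancestors_subset {R Q : σ} (h : Q ∈ G.ancestors R) : G.ancestors Q ⊆ G.ancestors R :=
  fun _ hQ => Relation.TransGen.trans hQ h

lemma wellFounded_ancestors [Finite σ] : WellFounded fun Q R => Q ∈ G.ancestors R := by
  have : IsTrans σ (Relation.TransGen G.edge) := ⟨fun _ _ _ => Relation.TransGen.trans⟩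
  have : Std.Irrefl (Relation.TransGen G.edge) := ⟨G.acyclic⟩
  exact Finite.wellFounded_of_trans_of_irrefl (Relation.TransGen G.edge)

/-- A rule that selects for every tuple one of the aggregation formulas of `R`, in dependence of
the ancestors of `R` only. -/
structure Selector where
  sel : (n : ℕ) → (R : σ) → RelStr ar (Fin n) → (Fin (ar R) → Fin n) → Fin (G.ν R)
  sel_congr : ∀ n R M M', (∀ Q ∈ G.ancestors R, M Q = M' Q) → sel n R M = sel n R M'

namespace Selector

variable {G} [Finite σ] (s : G.Selector) {n : ℕ}

/-- Well-founded recursion along the ancestor order. When `R` is reached only its ancestors are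
available; the recursion feeds the selector a structure in which all other symbols are empty, which
by `sel_congr` makes no difference. -/
lemma exists_str (B : G.Bits n) :
    ∃ M : RelStr ar (Fin n), ∀ R a, M R a ↔ B ⟨R, a, s.sel n R M a⟩ = true := by
  let F : (R : σ) → ((Q : σ) → Q ∈ G.ancestors R → (Fin (ar Q) → Fin n) → Prop) →
      (Fin (ar R) → Fin n) → Prop :=
    fun R ih a => B ⟨R, a, s.sel n R (fun Q v => ∃ h : Q ∈ G.ancestors R, ih Q h v) a⟩ = true
  refine ⟨G.wellFounded_ancestors.fix F, fun R a => ?_⟩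
  rw [WellFounded.fix_eq]
  simp only [F]
  rw [s.sel_congr n R _ (G.wellFounded_ancestors.fix F)]
  intro Q hQ
  funext v
  simp only [hQ, exists_true_left]
  rfl

/-- The structure determined by the random bits: `R` holds of a tuple if so does the bit with the
selected index. -/
noncomputable def str (B : G.Bits n) : RelStr ar (Fin n) := (s.exists_str B).choose

lemma str_iff (B : G.Bits n) (R : σ) (a : Fin (ar R) → Fin n) :
    s.str B R a ↔ B ⟨R, a, s.sel n R (s.str B) a⟩ = true :=
  (s.exists_str B).choose_spec R a

lemma eq_str {B : G.Bits n} {M : RelStr ar (Fin n)}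
    (h : ∀ R a, M R a ↔ B ⟨R, a, s.sel n R M a⟩ = true) : M = s.str B := by
  have : ∀ R, M R = s.str B R := fun R => by
    induction R using G.wellFounded_ancestors.induction with
    | _ R ih =>
      funext a
      rw [eq_iff_iff, h, s.str_iff, s.sel_congr n R M (s.str B) ih]
  exact funext this

lemma str_eq_iff {B : G.Bits n} {M : RelStr ar (Fin n)} :
    s.str B = M ↔ ∀ R a, B ⟨R, a, s.sel n R M a⟩ = true ↔ M R a :=
  ⟨fun h R a => by rw [← h, ← s.str_iff], fun h => (s.eq_str fun R a => (h R a).symm).symm⟩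

/-- Two selectors that agree on the structure given by the first one give the same structure. -/
lemma str_eq_str {s t : G.Selector} {B : G.Bits n}
    (h : ∀ R a, s.sel n R (s.str B) a = t.sel n R (s.str B) a) : s.str B = t.str B :=
  -- Agreement on this one structure suffices: it then solves the recursion of `t`, whose solution
  -- is unique.
  t.eq_str fun R a => by rw [← h, s.str_iff]

end Selector

/-- The truth value of the `i`-th aggregation formula of `R`. -/
def chiHolds {n : ℕ} (R : σ) (M : RelStr ar (Fin n)) (a : Fin (ar R) → Fin n) (i : Fin (G.ν R)) :
    Prop :=
  (G.χ R i).Holds M a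

lemma edge_subset_ancestors (R : σ) : {Q | G.edge Q R} ⊆ G.ancestors R :=
  fun _ h => Relation.TransGen.single h

lemma χ_over_ancestors (R : σ) (i : Fin (G.ν R)) : (G.χ R i).Over (G.ancestors R) :=
  CPL.over_mono (G.edge_subset_ancestors R) _ (G.χ_over R i)

open Classical in
/-- The selector given by the aggregation formulas. -/
noncomputable def selector : G.Selector where
  sel n R M a :=
    -- The default index is never used on a nonempty domain, by `exhaustive`.
    if h : ∃ i, G.chiHolds R M a i then h.choose else ⟨0, G.ν_pos R⟩
  sel_congr n R M M' h := by
    have : G.chiHolds R M = G.chiHolds R M' := by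
      funext a i
      exact propext (CPL.holds_congr h _ (G.χ_over_ancestors R i) a)
    simp only [this]

lemma holds_iff_eq_selector {n : ℕ} (hn : 0 < n) (R : σ) (M : RelStr ar (Fin n))
    (a : Fin (ar R) → Fin n) (i : Fin (G.ν R)) :
    (G.χ R i).Holds M a ↔ i = G.selector.sel n R M a := by
  have : Nonempty (Fin n) := ⟨⟨0, hn⟩⟩
  have h : ∃ i, G.chiHolds R M a i := G.exhaustive R (Fin n) M a
  have hs : (G.χ R (G.selector.sel n R M a)).Holds M a := by
    simp only [selector, h, dite_true]
    exact h.choose_spec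
  constructor
  · intro hi
    by_contra hne
    exact G.exclusive R _ _ hne (Fin n) M ⟨a, hi, hs⟩
  · rintro rfl
    exact hs

variable [Fintype σ]

/-- The outcome `M` prescribes exactly one bit for each symbol and tuple, the one with the index
selected in `M` itself. These bits are distinct, so the probability is a product; in `weight` only
the factor of the selected index `i` survives for each tuple. -/
lemma weight_eq {n : ℕ} (hn : 0 < n) (M : RelStr ar (Fin n)) :
    G.weight n M = (G.bitMeasure n).real {B | G.selector.str B = M} := by
  classical
  simp only [Selector.str_eq_iff]
  have := G.bitMeasure_real (n := n) (J := (R : σ) × (Fin (ar R) → Fin n))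
    (fun x => ⟨x.1, x.2, G.selector.sel n x.1 M x.2⟩)
    (by
      rintro ⟨R, a⟩ ⟨R', a'⟩ h
      simp only [Sigma.mk.injEq] at h
      obtain ⟨rfl, h⟩ := h
      simp only [heq_eq_eq, Prod.mk.injEq] at h
      rw [h.1])
    (fun x => M x.1 x.2)
  simp only [Sigma.forall] at this
  rw [this, Fintype.prod_sigma]
  unfold weight
  refine Finset.prod_congr rfl fun R _ => ?_
  simp only [Finset.prod_filter]
  rw [Finset.prod_comm]
  refine Finset.prod_congr rfl fun a _ => ?_
  simp only [G.holds_iff_eq_selector hn, Finset.prod_ite_eq', Finset.mem_univ, if_true]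
  unfold boolWeight
  split_ifs <;> rfl

/-- The random bits induce the distribution of the lifted Bayesian network. -/
lemma prob_eq {n : ℕ} (hn : 0 < n) (X : Set (RelStr ar (Fin n))) :
    G.prob n X = (G.bitMeasure n).real {B | G.selector.str B ∈ X} := by
  classical
  unfold prob
  have : {B : G.Bits n | G.selector.str B ∈ X} =
      ⋃ M ∈ (Finset.univ.filter fun M : RelStr ar (Fin n) => M ∈ X),
        {B | G.selector.str B = M} := by
    ext B
    simp
  rw [this, measureReal_biUnion_finset]
  · exact Finset.sum_congr rfl fun M _ => G.weight_eq hn M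
  · intro M _ M' _ hne
    refine Set.disjoint_left.2 fun B h h' => hne ?_
    exact Eq.trans (Eq.symm h) h'
  · exact fun M _ => Set.Finite.measurableSet (Set.toFinite _)

/-- Events that fail with exponentially small probability. -/
noncomputable def whp : Filter (Σ n, G.Bits n) := expSmallFilter G.Bits G.bitMeasure

lemma tendsto_fst_whp : Tendsto Sigma.fst G.whp atTop := tendsto_fst_expSmallFilter

end LiftedBN

/-! ### Representatives of identified variables -/

section Types

variable {σ : Type} {ar : σ → ℕ}

lemma Atom.rename_rename {k l m : ℕ} (f : Fin k → Fin l) (g : Fin l → Fin m) (t : Atom ar k) :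
    (t.rename f).rename g = t.rename (g ∘ f) := by
  cases t <;> rfl

lemma pull_pull {k l m : ℕ} (f : Fin k → Fin l) (g : Fin l → Fin m) (p : Set (Atom ar m)) :
    pull f (pull g p) = pull (g ∘ f) p := by
  ext t
  simp only [pull, Set.mem_ofPred_eq, Atom.rename_rename]

/-- The variable `x_i` is the first one in its class of variables identified by `p`. -/
def IsRep {k : ℕ} (p : Set (Atom ar k)) (i : Fin k) : Prop :=
  ∀ j, j < i → Atom.eq j i ∉ p

/-- Used to see that different atoms in representatives are governed by different bits, so that no
bit is counted twice. -/
lemma IsRep.eq_of_eq {k : ℕ} {p : Set (Atom ar k)} {A : Type} {a : Fin k → A}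
    (hid : ∀ i j, a i = a j ↔ Atom.eq i j ∈ p) {i j : Fin k} (hi : IsRep p i) (hj : IsRep p j)
    (h : a i = a j) : i = j := by
  rcases lt_trichotomy i j with hlt | rfl | hlt
  · exact absurd ((hid i j).1 h) (hj i hlt)
  · rfl
  · exact absurd ((hid j i).1 h.symm) (hi j hlt)

lemma exists_isRep {k : ℕ} {p : Set (Atom ar k)} {A : Type} {a : Fin k → A}
    (hid : ∀ i j, a i = a j ↔ Atom.eq i j ∈ p) (i : Fin k) : ∃ j, IsRep p j ∧ a j = a i := by
  obtain ⟨j, hj, hmin⟩ := wellFounded_lt.has_min {j : Fin k | a j = a i} ⟨i, rfl⟩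
  exact ⟨j, fun j' hlt h => hmin j' (((hid j' j).2 h).trans hj) hlt, hj⟩

lemma isRep_pull_castSucc {k : ℕ} (p : Set (Atom ar (k + 1))) (i : Fin k) :
    IsRep (pull Fin.castSucc p) i ↔ IsRep p i.castSucc := by
  constructor
  · intro h j hj
    obtain ⟨j, rfl⟩ := Fin.eq_castSucc_of_ne_last (ne_of_lt (lt_of_lt_of_le hj (Fin.le_last _)))
    exact h j (by simpa using hj)
  · exact fun h j hj => h j.castSucc (by simpa using hj)

/-- The number of new elements in the last place of a realization of `p`. -/
noncomputable def lastDim {k : ℕ} (p : Set (Atom ar (k + 1))) : ℕ := by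
  classical exact if IsRep p (Fin.last k) then 1 else 0

lemma snoc_comp_castSucc {A : Type} {k : ℕ} (a : Fin k → A) (z : A) :
    (Fin.snoc a z : Fin (k + 1) → A) ∘ Fin.castSucc = a := by
  funext i
  simp

end Types

/-! ### Local selectors and the exact probabilities of atomic types -/

namespace LiftedBN

variable {σ : Type} {ar : σ → ℕ} (G : LiftedBN ar) (S : Set σ)
  (c : (R : σ) → Set (Atom ar (ar R)) → Fin (G.ν R))

open Classical in
/-- The selector which for symbols in `S` uses the given function of the atomic type. -/
noncomputable def localSelector : G.Selector where
  sel n R M a := if R ∈ S then c R (diag (G.ancestors R) M a) else G.selector.sel n R M a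
  sel_congr n R M M' h := by
    funext a
    rw [diag_congr h, G.selector.sel_congr n R M M' h]

/-- The index selected for the tuple `x_v` by the type `p`. -/
def typeIdx {k : ℕ} (p : Set (Atom ar k)) (R : σ) (v : Fin (ar R) → Fin k) : Fin (G.ν R) :=
  c R (pull v p ∩ {t | t.Over (G.ancestors R)})

/-- The conditional probability of the literal about `R(x_v)` in the type `p`. -/
noncomputable def atomWeight {k : ℕ} (p : Set (Atom ar k)) (R : σ) (v : Fin (ar R) → Fin k) : ℝ :=
  boolWeight (G.μ R (G.typeIdx c p R v)) (Atom.rel R v ∈ p)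

variable {S}

lemma localSelector_sel (hS : ∀ R ∈ S, G.ancestors R ⊆ S) {n : ℕ} {R : σ} (hR : R ∈ S)
    (M : RelStr ar (Fin n)) {k : ℕ} (a : Fin k → Fin n) (v : Fin (ar R) → Fin k) :
    (G.localSelector S c).sel n R M (a ∘ v) = G.typeIdx c (diag S M a) R v := by
  simp only [localSelector, hR, if_true, typeIdx]
  rw [pull_diag, diag_inter_over (hS R hR)]

lemma atomWeight_nonneg {k : ℕ} (p : Set (Atom ar k)) (R : σ) (v : Fin (ar R) → Fin k) :
    0 ≤ G.atomWeight c p R v :=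
  boolWeight_nonneg (G.μ_mem _ _) _

lemma atomWeight_le_one {k : ℕ} (p : Set (Atom ar k)) (R : σ) (v : Fin (ar R) → Fin k) :
    G.atomWeight c p R v ≤ 1 :=
  boolWeight_le_one (G.μ_mem _ _) _

lemma atomWeight_pull {k l : ℕ} (f : Fin k → Fin l) (p : Set (Atom ar l)) (R : σ)
    (v : Fin (ar R) → Fin k) : G.atomWeight c (pull f p) R v = G.atomWeight c p R (f ∘ v) := by
  unfold atomWeight typeIdx
  rw [pull_pull]
  rfl

section Structure

variable [Finite σ] {n : ℕ} {B : G.Bits n} {k : ℕ} {a : Fin k → Fin n} {p : Set (Atom ar k)}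

/-- The selected index is dictated by `p`, so the bit concerned is a fixed coordinate, not one that
depends on `B`. -/
lemma bit_iff_of_diag (hS : ∀ R ∈ S, G.ancestors R ⊆ S)
    (h : diag S ((G.localSelector S c).str B) a = p) {R : σ} (hR : R ∈ S)
    (v : Fin (ar R) → Fin k) :
    B ⟨R, a ∘ v, G.typeIdx c p R v⟩ = true ↔ Atom.rel R v ∈ p := by
  rw [← h, rel_mem_diag hR, Selector.str_iff, G.localSelector_sel c hS hR]

/-- Converse of `bit_iff_of_diag`, by induction along the ancestor order: once the atoms over the
ancestors of `R` agree with `p`, the selected index is the one dictated by `p`, and the prescribed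
bit decides the atom. Every other atom expresses the same fact as an atom in representatives. The
first alternative of the hypothesis serves atoms whose truth is already known. -/
lemma diag_eq_of_bits (hS : ∀ R ∈ S, G.ancestors R ⊆ S) (hp : IsDiag S p)
    (hid : ∀ i j, a i = a j ↔ Atom.eq i j ∈ p)
    (h : ∀ R ∈ S, ∀ v : Fin (ar R) → Fin k, (∀ t, IsRep p (v t)) →
      ((G.localSelector S c).str B R (a ∘ v) ↔ Atom.rel R v ∈ p) ∨
      (B ⟨R, a ∘ v, G.typeIdx c p R v⟩ = true ↔ Atom.rel R v ∈ p)) :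
    diag S ((G.localSelector S c).str B) a = p := by
  refine diag_eq_of hp hid fun R => ?_
  induction R using G.wellFounded_ancestors.induction with
  | _ R ih =>
  intro hR v
  choose ρ hρ hρ' using exists_isRep hid
  have h1 : a ∘ v = a ∘ (ρ ∘ v) := by
    funext t
    exact (hρ' (v t)).symm
  have h2 : Atom.rel R v ∈ p ↔ Atom.rel R (ρ ∘ v) ∈ p := by
    have hp' := hp
    obtain ⟨A, _, M, a', rfl⟩ := hp'
    rw [rel_mem_diag hR, rel_mem_diag hR]
    have : a' ∘ v = a' ∘ (ρ ∘ v) := by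
      funext t
      exact (eq_mem_diag.1 ((hid _ _).1 (hρ' (v t)))).symm
    rw [this]
  rw [h1, h2]
  rcases h R hR (ρ ∘ v) (fun t => hρ _) with h | h
  · exact h
  · rw [← h, Selector.str_iff, G.localSelector_sel c hS hR]
    have : G.typeIdx c (diag S ((G.localSelector S c).str B) a) R (ρ ∘ v) =
        G.typeIdx c p R (ρ ∘ v) := by
      unfold typeIdx
      congr 1
      ext t
      refine and_congr_left fun ht => ?_
      change t.rename (ρ ∘ v) ∈ diag S ((G.localSelector S c).str B) a ↔ t.rename (ρ ∘ v) ∈ p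
      obtain ⟨A, _, M, a', rfl⟩ := hp
      cases t with
      | top => exact ⟨fun _ => ⟨trivial, trivial⟩, fun _ => ⟨trivial, trivial⟩⟩
      | eq i j =>
        exact eq_mem_diag.trans (hid _ _)
      | rel Q w =>
        have hQ : Q ∈ G.ancestors R := ht
        exact (rel_mem_diag (hS R hR hQ)).trans (ih Q hQ (hS R hR hQ) _)
    rw [this]

end Structure

variable [Fintype σ] (S)

open Classical in
/-- The relational atoms over `S` in the first variables of the classes of identified variables. -/
noncomputable def relIndex {k : ℕ} (p : Set (Atom ar k)) :
    Finset ((R : σ) × (Fin (ar R) → Fin k)) :=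
  Finset.univ.filter fun x => x.1 ∈ S ∧ ∀ t, IsRep p (x.2 t)

open Classical in
/-- The members of `relIndex` that involve the last variable. -/
noncomputable def extIndex {k : ℕ} (p : Set (Atom ar (k + 1))) :
    Finset ((R : σ) × (Fin (ar R) → Fin (k + 1))) :=
  (relIndex S p).filter fun x => ∃ t, x.2 t = Fin.last k

/-- The limit probability of the type `p`. -/
noncomputable def limP {k : ℕ} (p : Set (Atom ar k)) : ℝ :=
  ∏ x ∈ relIndex S p, G.atomWeight c p x.1 x.2

/-- The limit probability of the type `p` conditioned on its restriction to all variables but the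
last. -/
noncomputable def extP {k : ℕ} (p : Set (Atom ar (k + 1))) : ℝ :=
  ∏ x ∈ extIndex S p, G.atomWeight c p x.1 x.2

lemma limP_nonneg {k : ℕ} (p : Set (Atom ar k)) : 0 ≤ G.limP S c p :=
  Finset.prod_nonneg fun _ _ => G.atomWeight_nonneg c p _ _

lemma extP_nonneg {k : ℕ} (p : Set (Atom ar (k + 1))) : 0 ≤ G.extP S c p :=
  Finset.prod_nonneg fun _ _ => G.atomWeight_nonneg c p _ _

lemma extP_le_one {k : ℕ} (p : Set (Atom ar (k + 1))) : G.extP S c p ≤ 1 :=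
  Finset.prod_le_one (fun _ _ => G.atomWeight_nonneg c p _ _)
    fun _ _ => G.atomWeight_le_one c p _ _

variable {S}

lemma mem_relIndex {k : ℕ} {p : Set (Atom ar k)} {x : (R : σ) × (Fin (ar R) → Fin k)} :
    x ∈ relIndex S p ↔ x.1 ∈ S ∧ ∀ t, IsRep p (x.2 t) := by
  simp [relIndex]

lemma mem_extIndex {k : ℕ} {p : Set (Atom ar (k + 1))}
    {x : (R : σ) × (Fin (ar R) → Fin (k + 1))} :
    x ∈ extIndex S p ↔ (x.1 ∈ S ∧ ∀ t, IsRep p (x.2 t)) ∧ ∃ t, x.2 t = Fin.last k := by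
  simp only [extIndex, Finset.mem_filter, mem_relIndex]

/-- The atoms that avoid the last variable are those of the restricted type, with the same weights.
-/
lemma limP_eq_mul {k : ℕ} (p : Set (Atom ar (k + 1))) :
    G.limP S c p = G.limP S c (pull Fin.castSucc p) * G.extP S c p := by
  classical
  unfold limP extP extIndex
  rw [mul_comm, ← Finset.prod_filter_mul_prod_filter_not (relIndex S p)
    (fun x => ∃ t, x.2 t = Fin.last k)]
  congr 1
  · symm
    refine Finset.prod_bij (fun x _ => ⟨x.1, Fin.castSucc ∘ x.2⟩) ?_ ?_ ?_ ?_
    · rintro ⟨R, v⟩ hx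
      rw [mem_relIndex] at hx
      rw [Finset.mem_filter, mem_relIndex]
      refine ⟨⟨hx.1, fun t => (isRep_pull_castSucc p _).1 (hx.2 t)⟩, ?_⟩
      rintro ⟨t, ht⟩
      exact (Fin.castSucc_lt_last (v t)).ne ht
    · rintro ⟨R, v⟩ _ ⟨R', v'⟩ _ h
      simp only [Sigma.mk.injEq] at h
      obtain ⟨rfl, h⟩ := h
      rw [heq_eq_eq] at h
      congr 1
      funext t
      exact Fin.castSucc_injective _ (congrFun h t)
    · rintro ⟨R, v⟩ hx
      rw [Finset.mem_filter, mem_relIndex] at hx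
      obtain ⟨⟨hR, hrep⟩, hlast⟩ := hx
      have : ∀ t, ∃ i, Fin.castSucc i = v t := fun t => by
        obtain ⟨j, hj⟩ := Fin.eq_castSucc_of_ne_last (fun h => hlast ⟨t, h⟩)
        exact ⟨j, hj⟩
      choose w hw using this
      have hv : Fin.castSucc ∘ w = v := funext hw
      subst hv
      exact ⟨⟨R, w⟩, mem_relIndex.2 ⟨hR, fun t => (isRep_pull_castSucc p _).2 (hrep t)⟩, rfl⟩
    · rintro ⟨R, v⟩ _
      exact G.atomWeight_pull c _ p R v

/-- The probability that a tuple realizes a type. -/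
lemma prob_diag_eq (hS : ∀ R ∈ S, G.ancestors R ⊆ S) {n k : ℕ} {a : Fin k → Fin n}
    {p : Set (Atom ar k)} (hp : IsDiag S p) (hid : ∀ i j, a i = a j ↔ Atom.eq i j ∈ p) :
    (G.bitMeasure n).real {B | diag S ((G.localSelector S c).str B) a = p} = G.limP S c p := by
  -- Realizing `p` amounts to prescribing one fixed bit for each member of `relIndex S p`; hence the
  -- probability is the same for all `n`.
  have hset : {B : G.Bits n | diag S ((G.localSelector S c).str B) a = p} =
      {B | ∀ j : relIndex S p, B ⟨j.1.1, a ∘ j.1.2, G.typeIdx c p j.1.1 j.1.2⟩ = true ↔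
        Atom.rel j.1.1 j.1.2 ∈ p} := by
    ext B
    constructor
    · exact fun h j => G.bit_iff_of_diag c hS h (mem_relIndex.1 j.2).1 _
    · intro h
      refine G.diag_eq_of_bits c hS hp hid fun R hR v hv => Or.inr ?_
      exact h ⟨⟨R, v⟩, mem_relIndex.2 ⟨hR, hv⟩⟩
  rw [hset, G.bitMeasure_real (fun j : relIndex S p =>
    (⟨j.1.1, a ∘ j.1.2, G.typeIdx c p j.1.1 j.1.2⟩ : G.Coord n))]
  · exact Finset.prod_coe_sort (relIndex S p) fun x => G.atomWeight c p x.1 x.2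
  · rintro ⟨⟨R, v⟩, hv⟩ ⟨⟨R', v'⟩, hv'⟩ h
    simp only [Sigma.mk.injEq] at h
    obtain ⟨rfl, h⟩ := h
    simp only [heq_eq_eq, Prod.mk.injEq] at h
    have : v = v' := funext fun t =>
      IsRep.eq_of_eq hid ((mem_relIndex.1 hv).2 t) ((mem_relIndex.1 hv').2 t) (congrFun h.1 t)
    subst this
    rfl

end LiftedBN

/-! ### One-variable extensions of a realized type -/

section Types

variable {σ : Type} {ar : σ → ℕ}

/-- If the last variable is identified with an earlier one, then there is exactly one extension. -/
lemma diag_snoc_eq_iff_of_eq_last {S : Set σ} {k : ℕ} {p : Set (Atom ar (k + 1))} (hp : IsDiag S p)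
    {j : Fin k} (hj : Atom.eq j.castSucc (Fin.last k) ∈ p) {A : Type} {M : RelStr ar A}
    {a : Fin k → A} (ha : diag S M a = pull Fin.castSucc p) (z : A) :
    diag S M (Fin.snoc a z : Fin (k + 1) → A) = p ↔ z = a j := by
  constructor
  · rintro rfl
    have := eq_mem_diag.1 hj
    simpa using this.symm
  · rintro rfl
    -- Substituting `x_j` for the last variable recovers `p` from its restriction.
    let g : Fin (k + 1) → Fin k := Fin.snoc id j
    have h1 : (Fin.snoc a (a j) : Fin (k + 1) → A) = a ∘ g := by
      funext i
      refine Fin.lastCases ?_ (fun i => ?_) i <;> simp [g]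
    rw [h1, ← pull_diag, ha, pull_pull]
    obtain ⟨A', _, M', a', rfl⟩ := hp
    rw [pull_diag]
    congr 1
    funext i
    refine Fin.lastCases ?_ (fun i => ?_) i
    · simpa [g] using eq_mem_diag.1 hj
    · simp [g]

lemma exists_eq_last_of_not_isRep {k : ℕ} {p : Set (Atom ar (k + 1))}
    (h : ¬ IsRep p (Fin.last k)) : ∃ j : Fin k, Atom.eq j.castSucc (Fin.last k) ∈ p := by
  unfold IsRep at h
  push Not at h
  obtain ⟨j, hj, hjp⟩ := h
  obtain ⟨i, rfl⟩ := Fin.eq_castSucc_of_ne_last hj.ne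
  exact ⟨i, hjp⟩

lemma snoc_identities {S : Set σ} {k n : ℕ} {p : Set (Atom ar (k + 1))} {a : Fin k → Fin n}
    (hp : IsDiag S p) (hlast : IsRep p (Fin.last k))
    (hid : ∀ i j, a i = a j ↔ Atom.eq i j ∈ pull Fin.castSucc p) {z : Fin n}
    (hz : z ∉ Set.range a) (i j : Fin (k + 1)) :
    (Fin.snoc a z : Fin (k + 1) → Fin n) i = (Fin.snoc a z : Fin (k + 1) → Fin n) j ↔
      Atom.eq i j ∈ p := by
  have hsymm : ∀ i j, Atom.eq i j ∈ p ↔ Atom.eq j i ∈ p := by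
    obtain ⟨A, _, M, a', rfl⟩ := hp
    intro i j
    rw [eq_mem_diag, eq_mem_diag, eq_comm]
  have hrefl : ∀ i, Atom.eq i i ∈ p := by
    obtain ⟨A, _, M, a', rfl⟩ := hp
    exact fun i => eq_mem_diag.2 rfl
  have hne : ∀ i, Atom.eq (Fin.castSucc i) (Fin.last k) ∉ p :=
    fun i => hlast _ (Fin.castSucc_lt_last i)
  refine Fin.lastCases ?_ (fun i => ?_) i <;> refine Fin.lastCases ?_ (fun j => ?_) j
  · simp [hrefl]
  · rw [hsymm]
    simp only [Fin.snoc_last, Fin.snoc_castSucc, hne, iff_false]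
    exact fun h => hz ⟨j, h.symm⟩
  · simp only [Fin.snoc_last, Fin.snoc_castSucc, hne, iff_false]
    exact fun h => hz ⟨i, h⟩
  · simp only [Fin.snoc_castSucc]
    exact hid i j

end Types

namespace LiftedBN

variable {σ : Type} {ar : σ → ℕ} (G : LiftedBN ar) {S : Set σ}
  (c : (R : σ) → Set (Atom ar (ar R)) → Fin (G.ν R)) [Fintype σ]

/-- The event that the bits for the atoms of `p` in the last variable have the values given by
`p`. -/
def extEvent (S : Set σ) {k : ℕ} (p : Set (Atom ar (k + 1))) {n : ℕ} (a : Fin k → Fin n)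
    (z : Fin n) : Set (G.Bits n) :=
  {B | ∀ j : extIndex S p, B ⟨j.1.1, (Fin.snoc a z : Fin (k + 1) → Fin n) ∘ j.1.2,
    G.typeIdx c p j.1.1 j.1.2⟩ = true ↔ Atom.rel j.1.1 j.1.2 ∈ p}

variable {k n : ℕ} {p : Set (Atom ar (k + 1))} {a : Fin k → Fin n}

/-- Atoms without the last variable are settled by `ha`, the others by the bits in `extEvent`. The
latter event is defined without reference to the type of `a`, so no conditioning is needed
afterwards. -/
lemma diag_snoc_eq_iff (hS : ∀ R ∈ S, G.ancestors R ⊆ S) (hp : IsDiag S p)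
    (hlast : IsRep p (Fin.last k)) {B : G.Bits n}
    (ha : diag S ((G.localSelector S c).str B) a = pull Fin.castSucc p) {z : Fin n}
    (hz : z ∉ Set.range a) :
    diag S ((G.localSelector S c).str B) (Fin.snoc a z : Fin (k + 1) → Fin n) = p ↔
      B ∈ G.extEvent c S p a z := by
  constructor
  · exact fun h j => G.bit_iff_of_diag c hS h (mem_extIndex.1 j.2).1.1 _
  · intro h
    have hid : ∀ i j, a i = a j ↔ Atom.eq i j ∈ pull Fin.castSucc p := fun i j => by
      rw [← ha, eq_mem_diag]
    refine G.diag_eq_of_bits c hS hp (snoc_identities hp hlast hid hz) fun R hR v hv => ?_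
    by_cases hvl : ∃ t, v t = Fin.last k
    · exact Or.inr (h ⟨⟨R, v⟩, mem_extIndex.2 ⟨⟨hR, hv⟩, hvl⟩⟩)
    · left
      have : ∀ t, ∃ i, Fin.castSucc i = v t := fun t => by
        obtain ⟨j, hj⟩ := Fin.eq_castSucc_of_ne_last (fun h => hvl ⟨t, h⟩)
        exact ⟨j, hj⟩
      choose w hw using this
      obtain rfl : Fin.castSucc ∘ w = v := funext hw
      rw [← Function.comp_assoc, snoc_comp_castSucc]
      refine (rel_mem_diag hR).symm.trans ?_
      rw [ha]
      rfl

/-- Each atom in `extIndex` contains the last variable and `z` lies outside `a`, so the tuple of a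
bit reveals `z`. Consequently the events for different `z` involve disjoint sets of bits. -/
lemma extEvent_injective (hp : IsDiag S p) (hlast : IsRep p (Fin.last k))
    (hid : ∀ i j, a i = a j ↔ Atom.eq i j ∈ pull Fin.castSucc p) :
    Function.Injective fun x : {z // z ∉ Set.range a} × extIndex S p =>
      (⟨x.2.1.1, (Fin.snoc a x.1.1 : Fin (k + 1) → Fin n) ∘ x.2.1.2,
        G.typeIdx c p x.2.1.1 x.2.1.2⟩ : G.Coord n) := by
  rintro ⟨⟨z, hz⟩, ⟨⟨R, v⟩, hv⟩⟩ ⟨⟨z', hz'⟩, ⟨⟨R', v'⟩, hv'⟩⟩ h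
  simp only [Sigma.mk.injEq] at h
  obtain ⟨rfl, h⟩ := h
  simp only [heq_eq_eq, Prod.mk.injEq] at h
  have hv1 := mem_extIndex.1 hv
  have hv2 := mem_extIndex.1 hv'
  have hzz : z = z' := by
    obtain ⟨t, ht⟩ := hv1.2
    have h1 := congrFun h.1 t
    simp only [Function.comp_apply] at h1 ht
    rw [ht, Fin.snoc_last] at h1
    revert h1
    refine Fin.lastCases ?_ (fun i => ?_) (v' t)
    · simp
    · intro h1
      rw [Fin.snoc_castSucc] at h1
      exact absurd ⟨i, h1.symm⟩ hz
  subst hzz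
  have : v = v' := funext fun t => IsRep.eq_of_eq (snoc_identities hp hlast hid hz)
    (hv1.1.2 t) (hv2.1.2 t) (congrFun h.1 t)
  subst this
  rfl

lemma extEvent_prob_inter (hp : IsDiag S p) (hlast : IsRep p (Fin.last k))
    (hid : ∀ i j, a i = a j ↔ Atom.eq i j ∈ pull Fin.castSucc p)
    (s : Finset {z // z ∉ Set.range a}) :
    (G.bitMeasure n).real (⋂ z ∈ s, G.extEvent c S p a z.1) = ∏ _z ∈ s, G.extP S c p := by
  have hset : (⋂ z ∈ s, G.extEvent c S p a z.1) =
      {B | ∀ x : s × extIndex S p,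
        B ⟨x.2.1.1, (Fin.snoc a x.1.1.1 : Fin (k + 1) → Fin n) ∘ x.2.1.2,
          G.typeIdx c p x.2.1.1 x.2.1.2⟩ = true ↔ Atom.rel x.2.1.1 x.2.1.2 ∈ p} := by
    ext B
    simp only [Set.mem_iInter]
    exact ⟨fun h x => h x.1.1 x.1.2 x.2, fun h z hz j => h (⟨z, hz⟩, j)⟩
  have hinj := (G.extEvent_injective c hp hlast hid).comp
    (Function.Injective.prodMap (Subtype.val_injective (p := (· ∈ s)))
      (Function.injective_id (α := extIndex S p)))
  rw [hset]
  refine (G.bitMeasure_real _ hinj fun x => Atom.rel x.2.1.1 x.2.1.2 ∈ p).trans ?_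
  rw [Fintype.prod_prod_type, ← Finset.prod_coe_sort s]
  refine Finset.prod_congr rfl fun z _ => ?_
  exact Finset.prod_coe_sort (extIndex S p) fun x => G.atomWeight c p x.1 x.2

lemma measurableSet_bits {n : ℕ} (X : Set (G.Bits n)) : MeasurableSet X :=
  Set.Finite.measurableSet (Set.toFinite _)

/-- The bad event is contained in a large deviation of the number of independent events `extEvent`.
One `ε` is the deviation in Hoeffding's inequality, the other covers the at most `k ≤ ε n` elements
of `a`, which are not eligible as `z`. -/
lemma prob_count_extensions_le (hS : ∀ R ∈ S, G.ancestors R ⊆ S) (hp : IsDiag S p)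
    (hlast : IsRep p (Fin.last k)) {ε : ℝ} (hε : 0 < ε) (hn : (k + 1 : ℝ) ≤ ε * n) (hn0 : 0 < n) :
    (G.bitMeasure n).real {B | ¬ (diag S ((G.localSelector S c).str B) a = pull Fin.castSucc p →
      |({z | diag S ((G.localSelector S c).str B) (Fin.snoc a z : Fin (k + 1) → Fin n) = p}.ncard
        : ℝ) - G.extP S c p * n| ≤ 2 * ε * n)} ≤ 2 * Real.exp (-(2 * ε ^ 2) * n) := by
  classical
  by_cases hid : ∀ i j, a i = a j ↔ Atom.eq i j ∈ pull Fin.castSucc p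
  swap
  · have : {B : G.Bits n | ¬ (diag S ((G.localSelector S c).str B) a = pull Fin.castSucc p →
      |({z | diag S ((G.localSelector S c).str B) (Fin.snoc a z : Fin (k + 1) → Fin n) = p}.ncard
        : ℝ) - G.extP S c p * n| ≤ 2 * ε * n)} = ∅ := by
      ext B
      simp only [Set.mem_ofPred_eq, Set.mem_empty_iff_false, iff_false, not_not]
      intro h
      exact absurd (fun i j => by rw [← h, eq_mem_diag]) hid
    rw [this, measureReal_empty]
    positivity
  set Z := {z // z ∉ Set.range a}
  set E : Z → Set (G.Bits n) := fun z => G.extEvent c S p a z.1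
  have hE1 : ∀ z, (G.bitMeasure n).real (E z) = G.extP S c p := fun z => by
    simpa using G.extEvent_prob_inter c hp hlast hid {z}
  have hind : iIndepSet E (G.bitMeasure n) := by
    rw [iIndepSet_iff_meas_biInter fun z => G.measurableSet_bits _]
    intro s
    rw [← ENNReal.toReal_eq_toReal_iff' (measure_ne_top _ _)
      (ENNReal.prod_ne_top fun _ _ => measure_ne_top _ _), ENNReal.toReal_prod]
    refine (G.extEvent_prob_inter c hp hlast hid s).trans (Finset.prod_congr rfl fun z _ => ?_)
    exact (hE1 z).symm
  have hcard : Fintype.card Z + (Set.range a).ncard = n := by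
    have h1 : Fintype.card Z = (Set.range a)ᶜ.ncard := by
      rw [Set.ncard_eq_toFinset_card', Set.toFinset_card]
      exact Fintype.card_congr (Equiv.refl _)
    rw [h1, add_comm, Set.ncard_add_ncard_compl, Nat.card_eq_fintype_card, Fintype.card_fin]
  have hrange : (Set.range a).ncard ≤ k := by
    rw [← Set.image_univ]
    refine (Set.ncard_image_le Set.finite_univ).trans ?_
    simp [Set.ncard_univ]
  have hcard' : (Fintype.card Z : ℝ) + (Set.range a).ncard = n := by exact_mod_cast hcard
  have hrange' : ((Set.range a).ncard : ℝ) ≤ k := by exact_mod_cast hrange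
  have hπ0 := G.extP_nonneg S c p
  have hc0 : (0 : ℝ) ≤ (Set.range a).ncard := Nat.cast_nonneg _
  refine le_trans (measureReal_mono ?_) (hoeffding_count (G.bitMeasure n)
    (fun z => G.measurableSet_bits _) hind hE1 (N := n) (by linarith) (by exact_mod_cast hn0) hε.le)
  intro B hB
  simp only [Set.mem_ofPred_eq, Classical.not_imp, not_le] at hB ⊢
  obtain ⟨ha, hB⟩ := hB
  have hcount : {z | diag S ((G.localSelector S c).str B)
      (Fin.snoc a z : Fin (k + 1) → Fin n) = p} = Subtype.val '' {z : Z | B ∈ E z} := by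
    ext z
    by_cases hz : z ∈ Set.range a
    · obtain ⟨i, rfl⟩ := hz
      constructor
      · intro h
        refine absurd ?_ (hlast i.castSucc (Fin.castSucc_lt_last i))
        rw [← h]
        exact eq_mem_diag.2 (by simp)
      · rintro ⟨⟨z, hz⟩, _, h⟩
        exact absurd ⟨i, h.symm⟩ hz
    · refine (G.diag_snoc_eq_iff c hS hp hlast ha hz).trans ?_
      exact ⟨fun h => ⟨⟨z, hz⟩, h, rfl⟩, by rintro ⟨⟨z, _⟩, h, rfl⟩; exact h⟩
  rw [hcount, Set.ncard_image_of_injective _ Subtype.val_injective] at hB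
  have hπ1 := G.extP_le_one S c p
  set X := ({z : Z | B ∈ E z}.ncard : ℝ)
  have h1 : |X - G.extP S c p * n| ≤
      |X - Fintype.card Z * G.extP S c p| + G.extP S c p * (Set.range a).ncard := by
    have : X - G.extP S c p * n =
        (X - Fintype.card Z * G.extP S c p) - G.extP S c p * (Set.range a).ncard := by
      rw [← hcard']
      ring
    rw [this]
    refine (abs_sub _ _).trans ?_
    rw [abs_of_nonneg (mul_nonneg hπ0 hc0)]
  have h2 : G.extP S c p * (Set.range a).ncard ≤ ε * n := by
    nlinarith
  linarith

end LiftedBN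

/-! ### High-probability statements for the local structure and transfer to the network -/

namespace LiftedBN

variable {σ : Type} {ar : σ → ℕ} (G : LiftedBN ar) {S : Set σ}
  (c : (R : σ) → Set (Atom ar (ar R)) → Fin (G.ν R)) [Fintype σ]

/-- With high probability, all numbers of one-variable extensions are close to their expected
values. -/
lemma eventually_count_extensions (hS : ∀ R ∈ S, G.ancestors R ⊆ S) {k : ℕ}
    {p : Set (Atom ar (k + 1))} (hp : IsDiag S p) {ε : ℝ} (hε : 0 < ε) :
    ∀ᶠ x in G.whp, ∀ a : Fin k → Fin x.1,
      diag S ((G.localSelector S c).str x.2) a = pull Fin.castSucc p →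
      |({z | diag S ((G.localSelector S c).str x.2) (Fin.snoc a z : Fin (k + 1) → Fin x.1) =
        p}.ncard : ℝ) - G.extP S c p * (x.1 : ℝ) ^ lastDim p| ≤ ε * (x.1 : ℝ) ^ lastDim p := by
  by_cases hlast : IsRep p (Fin.last k)
  · have hd : lastDim p = 1 := by simp [lastDim, hlast]
    simp only [hd, pow_one]
    refine eventually_expSmallFilter_forall_tuple (C := 2) (c := 2 * (ε / 2) ^ 2) (by positivity)
      (Q := fun n B a => diag S ((G.localSelector S c).str B) a = pull Fin.castSucc p →
        |({z | diag S ((G.localSelector S c).str B) (Fin.snoc a z : Fin (k + 1) → Fin n) =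
          p}.ncard : ℝ) - G.extP S c p * (n : ℝ)| ≤ ε * (n : ℝ)) ?_
    have hl : ∀ᶠ n : ℕ in atTop, ((k : ℝ) + 1) / (ε / 2) ≤ n :=
      tendsto_natCast_atTop_atTop.eventually_ge_atTop _
    filter_upwards [hl, eventually_gt_atTop 0] with n hn hn0 a
    rw [div_le_iff₀ (by positivity), mul_comm] at hn
    have := G.prob_count_extensions_le c hS hp hlast (a := a) (half_pos hε) hn hn0
    rwa [mul_div_cancel₀ ε two_ne_zero] at this
  · obtain ⟨j, hj⟩ := exists_eq_last_of_not_isRep hlast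
    have hd : lastDim p = 0 := by simp [lastDim, hlast]
    -- The last variable is no representative, so `extIndex` is empty; this matches the unique
    -- extension.
    have hP : G.extP S c p = 1 := by
      refine Finset.prod_eq_one fun x hx => ?_
      obtain ⟨⟨_, h⟩, t, ht⟩ := mem_extIndex.1 hx
      exact absurd (ht ▸ h t) hlast
    refine Eventually.of_forall fun x a ha => ?_
    have : {z | diag S ((G.localSelector S c).str x.2) (Fin.snoc a z : Fin (k + 1) → Fin x.1) =
        p} = {a j} := by
      ext z
      exact diag_snoc_eq_iff_of_eq_last hp hj ha z
    rw [this, hd, hP]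
    simp [hε.le]

/-- With high probability, no type of limit probability zero is realized. -/
lemma eventually_limP_ne_zero (hS : ∀ R ∈ S, G.ancestors R ⊆ S) (k : ℕ) :
    ∀ᶠ x in G.whp, ∀ a : Fin k → Fin x.1,
      G.limP S c (diag S ((G.localSelector S c).str x.2) a) ≠ 0 := by
  classical
  have : Fintype (Set (Atom ar k)) := Fintype.ofFinite _
  -- For each single tuple the probability is exactly `0`, since type probabilities equal `limP`.
  refine eventually_expSmallFilter_forall_tuple (C := 0) (c := 1) one_pos
    (Q := fun n B a => G.limP S c (diag S ((G.localSelector S c).str B) a) ≠ 0) ?_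
  filter_upwards [eventually_gt_atTop 0] with n hn a
  have hne : Nonempty (Fin n) := ⟨⟨0, hn⟩⟩
  rw [zero_mul]
  have hset : {B : G.Bits n | ¬ G.limP S c (diag S ((G.localSelector S c).str B) a) ≠ 0} =
      ⋃ p : Set (Atom ar k),
        {B | diag S ((G.localSelector S c).str B) a = p ∧ G.limP S c p = 0} := by
    ext B
    simp
  rw [hset]
  refine (measureReal_iUnion_fintype_le _).trans (Finset.sum_nonpos fun p _ => ?_)
  rcases Set.eq_empty_or_nonempty
    {B : G.Bits n | diag S ((G.localSelector S c).str B) a = p ∧ G.limP S c p = 0} with h | h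
  · rw [h, measureReal_empty]
  · obtain ⟨B, rfl, h0⟩ := h
    refine (measureReal_mono fun B' hB' => hB'.1).trans
      (G.prob_diag_eq c hS (isDiag_diag _ _ _) fun i j => eq_mem_diag.symm).le |>.trans h0.le

/-- If the aggregation formulas of the symbols in `S` depend only on the atomic types with high
probability, then the local selector gives the same structure with high probability. -/
lemma eventually_str_eq
    (h : ∀ R ∈ S, ∀ᶠ x in G.whp, ∀ a, G.selector.sel x.1 R (G.selector.str x.2) a =
      c R (diag (G.ancestors R) (G.selector.str x.2) a)) :
    ∀ᶠ x in G.whp, G.selector.str x.2 = (G.localSelector S c).str x.2 := by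
  have h' : ∀ᶠ x in G.whp, ∀ R, R ∈ S → ∀ a, G.selector.sel x.1 R (G.selector.str x.2) a =
      c R (diag (G.ancestors R) (G.selector.str x.2) a) := by
    rw [eventually_all]
    intro R
    by_cases hR : R ∈ S
    · exact (h R hR).mono fun x hx _ => hx
    · exact Eventually.of_forall fun x hR' => absurd hR' hR
  refine h'.mono fun x hx => Selector.str_eq_str fun R a => ?_
  by_cases hR : R ∈ S
  · simp only [localSelector, hR, if_true]
    exact hx R hR a
  · simp only [localSelector, hR, if_false]

/-- For the local structure the probability equals `limP` exactly; passing to the true structure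
changes it by at most the probability that the two differ. -/
lemma isLimitProb_lits (hS : ∀ R ∈ S, G.ancestors R ⊆ S)
    (h : ∀ᶠ x in G.whp, G.selector.str x.2 = (G.localSelector S c).str x.2) {k : ℕ}
    {p : Set (Atom ar k)} (hp : IsDiag S p) : G.IsLimitProb (lits S p) (G.limP S c p) := by
  intro ε hε
  obtain ⟨c', hc', h⟩ := eventually_expSmallFilter.1 h
  have hlim : Tendsto (fun n : ℕ => Real.exp (-c' * n)) atTop (nhds 0) :=
    Real.tendsto_exp_atBot.comp
      (tendsto_natCast_atTop_atTop.const_mul_atTop_of_neg (neg_lt_zero.2 hc'))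
  filter_upwards [h, hlim.eventually_le_const hε, eventually_gt_atTop 0] with n hn hnε hn0 a ha
  rw [realizesIdentities_lits] at ha
  rw [G.prob_eq hn0, ← G.prob_diag_eq c hS hp ha]
  simp only [Set.mem_ofPred_eq, realizes_lits hp]
  refine le_trans (le_trans ?_ hn) hnε
  have key : ∀ s t : G.Selector,
      (G.bitMeasure n).real {B | diag S (s.str B) a = p} ≤
        (G.bitMeasure n).real {B | diag S (t.str B) a = p} +
        (G.bitMeasure n).real {B | ¬ s.str B = t.str B} := by
    intro s t
    refine le_trans (measureReal_mono ?_) (measureReal_union_le _ _)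
    intro B hB
    by_cases hst : s.str B = t.str B
    · left
      simp only [Set.mem_ofPred_eq] at hB ⊢
      rwa [← hst]
    · exact Or.inr hst
  have h1 := key G.selector (G.localSelector S c)
  have h2 := key (G.localSelector S c) G.selector
  simp only [eq_comm (a := (G.localSelector S c).str _)] at h2
  rw [abs_le]
  constructor <;> linarith

end LiftedBN

/-! ### Counting extensions by several variables -/

section Counting

variable {σ : Type} {ar : σ → ℕ}

/-- A random structure in which the numbers of extensions are governed by the probabilities `P` of
the atomic `S`-types: no type of probability zero is realized, and every realization of a type has
the expected number of one-variable extensions. Here `F` is the filter of likely events. -/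
structure Saturated (S : Set σ) {X : Type} (F : Filter X) (n : X → ℕ)
    (M : (x : X) → RelStr ar (Fin (n x))) (P : {k : ℕ} → Set (Atom ar k) → ℝ) : Prop where
  tendsto : Tendsto n F atTop
  nonneg : ∀ {k : ℕ} (p : Set (Atom ar k)), 0 ≤ P p
  eq_zero : ∀ {k : ℕ} (p : Set (Atom ar (k + 1))), P (pull Fin.castSucc p) = 0 → P p = 0
  ne_zero : ∀ k : ℕ, ∀ᶠ x in F, ∀ a : Fin k → Fin (n x), P (diag S (M x) a) ≠ 0
  ext : ∀ {k : ℕ} {p : Set (Atom ar (k + 1))}, IsDiag S p → ∀ ε : ℝ, 0 < ε → ∀ᶠ x in F,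
    ∀ a : Fin k → Fin (n x), diag S (M x) a = pull Fin.castSucc p →
      |({z | diag S (M x) (Fin.snoc a z : Fin (k + 1) → Fin (n x)) = p}.ncard : ℝ) -
        P p / P (pull Fin.castSucc p) * (n x : ℝ) ^ lastDim p| ≤ ε * (n x : ℝ) ^ lastDim p

/-- The number of new elements in the last `e` places of a realization of `p`. -/
noncomputable def extDim {d : ℕ} : (e : ℕ) → Set (Atom ar (d + e)) → ℕ
  | 0, _ => 0
  | e + 1, p => extDim e (pull (Fin.castSucc : Fin (d + e) → Fin (d + e + 1)) p) +
      lastDim (k := d + e) p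

lemma ncard_eq_sum_snoc {A : Type} [Finite A] {e : ℕ} (Q : (Fin (e + 1) → A) → Prop)
    (K : Finset (Fin e → A)) (h : ∀ b z, Q (Fin.snoc b z) → b ∈ K) :
    {b | Q b}.ncard = ∑ b ∈ K, {z | Q (Fin.snoc b z)}.ncard := by
  classical
  have := Fintype.ofFinite A
  rw [Set.ncard_eq_toFinset_card', Finset.card_eq_sum_card_fiberwise
    (f := fun b : Fin (e + 1) → A => (Fin.init b : Fin e → A)) (t := K)]
  · refine Finset.sum_congr rfl fun b _ => ?_
    rw [Set.ncard_eq_toFinset_card']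
    symm
    refine Finset.card_bij (fun z _ => Fin.snoc b z) ?_ ?_ ?_
    · intro z hz
      simpa using hz
    · intro z _ z' _ hzz
      simpa using congrFun hzz (Fin.last e)
    · intro b' hb'
      simp only [Set.toFinset_ofPred, Finset.mem_filter, Finset.mem_univ, true_and] at hb'
      obtain ⟨hb', rfl⟩ := hb'
      exact ⟨b' (Fin.last e), by simpa [Fin.snoc_init_self] using hb', Fin.snoc_init_self b'⟩
  · intro b hb
    simp only [Set.toFinset_ofPred, Finset.coe_filter, Finset.mem_univ, true_and] at hb
    refine h _ (b (Fin.last e)) ?_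
    rw [Fin.snoc_init_self]
    exact hb

lemma Saturated.count {S : Set σ} {X : Type} {F : Filter X} {n : X → ℕ}
    {M : (x : X) → RelStr ar (Fin (n x))} {P : {k : ℕ} → Set (Atom ar k) → ℝ}
    (h : Saturated S F n M P) {d : ℕ} : ∀ (e : ℕ) (p : Set (Atom ar (d + e))), IsDiag S p →
    ∀ ε : ℝ, 0 < ε → ∀ᶠ x in F, ∀ a : Fin d → Fin (n x),
      diag S (M x) a = pull (Fin.castAdd e) p →
      |({b : Fin e → Fin (n x) | diag S (M x) (Fin.append a b) = p}.ncard : ℝ) -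
        P p / P (pull (Fin.castAdd e) p) * (n x : ℝ) ^ extDim e p| ≤
          ε * (n x : ℝ) ^ extDim e p
  | 0, p, _, ε, hε => by
    filter_upwards [h.ne_zero d] with x hx a ha
    have hp : pull (Fin.castAdd 0) p = p := by
      ext t
      cases t <;> rfl
    have h0 := hx a
    rw [ha] at h0
    have hset : {b : Fin 0 → Fin (n x) | diag S (M x) (Fin.append a b) = p} = {Fin.elim0} := by
      ext b
      simp only [Set.mem_ofPred_eq, Set.mem_singleton_iff, Subsingleton.elim b Fin.elim0, iff_true]
      rw [Fin.append_elim0]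
      exact ha.trans hp
    rw [hp] at h0
    rw [hset, hp, div_self h0]
    simp [extDim, hε.le]
  | e + 1, p, hp, ε, hε => by
    classical
    set p' : Set (Atom ar (d + e)) := pull (Fin.castSucc : Fin (d + e) → Fin (d + e + 1)) p
      with hp'
    set q := pull (Fin.castAdd (e + 1)) p with hq
    have hpq : pull (Fin.castAdd e) p' = q := pull_pull _ _ _
    set u : ℝ := P p' / P q
    set w : ℝ := P p / P p'
    have hu : 0 ≤ u := div_nonneg (h.nonneg _) (h.nonneg _)
    have hw : 0 ≤ w := div_nonneg (h.nonneg (k := d + (e + 1)) _) (h.nonneg _)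
    -- If `P p' = 0`, then `w = 0` by the convention on division, and the left side vanishes by
    -- `eq_zero`.
    have hmul : P p / P q = u * w := by
      by_cases h0 : P p' = 0
      · have := h.eq_zero (k := d + e) p h0
        simp only [u, w, h0]
        rw [show P p = 0 from this]
        simp
      · simp only [u, w]
        rw [mul_comm]
        exact (div_mul_div_cancel₀ h0).symm
    -- With `N' = (u ± ε') m ^ D` realizations of `p'`, each with `(w ± ε') m ^ δ` extensions, the
    -- error is at most `(u + ε') ε' + w ε'`, and `ε' ≤ 1` bounds this by `(u + 1 + w) ε'`.
    set ε' := min 1 (ε / (u + 1 + w))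
    have hε' : 0 < ε' := lt_min one_pos (by positivity)
    have hε1 : ε' ≤ 1 := min_le_left _ _
    have hε2 : (u + 1 + w) * ε' ≤ ε := by
      rw [mul_comm, ← le_div_iff₀ (by positivity)]
      exact min_le_right _ _
    have ih := h.count e p' (hp.pull _) ε' hε'
    rw [hpq] at ih
    filter_upwards [ih, h.ext (k := d + e) hp ε' hε'] with x hx1 hx2 a ha
    specialize hx1 a ha
    set K : Finset (Fin e → Fin (n x)) :=
      {b : Fin e → Fin (n x) | diag S (M x) (Fin.append a b) = p'}.toFinset with hK
    have hcount := ncard_eq_sum_snoc (fun b : Fin (e + 1) → Fin (n x) =>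
      diag S (M x) (Fin.append a b) = p) K (by
        intro b z hbz
        rw [Fin.append_snoc] at hbz
        rw [hK, Set.mem_toFinset]
        change _ = _
        rw [hp', ← hbz]
        refine Eq.trans ?_ (pull_diag _ _ _ _).symm
        rw [snoc_comp_castSucc])
    rw [hmul, hcount]
    rw [Set.ncard_eq_toFinset_card', ← hK] at hx1
    set N' : ℝ := (K.card : ℝ)
    set D := extDim e p'
    set δ := lastDim (k := d + e) p
    have hD : extDim (e + 1) p = D + δ := rfl
    rw [hD, pow_add]
    push_cast
    set m : ℝ := (n x : ℝ)
    have hm : 0 ≤ m := Nat.cast_nonneg _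
    have hmD : 0 ≤ m ^ D := pow_nonneg hm _
    have hmδ : 0 ≤ m ^ δ := pow_nonneg hm _
    have hsum : |∑ b ∈ K, ({z | diag S (M x) (Fin.append a (Fin.snoc b z : Fin (e + 1) →
        Fin (n x))) = p}.ncard : ℝ) - N' * (w * m ^ δ)| ≤ N' * (ε' * m ^ δ) := by
      have : N' * (w * m ^ δ) = ∑ _b ∈ K, w * m ^ δ := by
        rw [Finset.sum_const, nsmul_eq_mul]
      rw [this, ← Finset.sum_sub_distrib]
      refine (Finset.abs_sum_le_sum_abs _ _).trans ?_
      rw [show N' * (ε' * m ^ δ) = ∑ _b ∈ K, ε' * m ^ δ by rw [Finset.sum_const, nsmul_eq_mul]]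
      refine Finset.sum_le_sum fun b hb => ?_
      rw [hK, Set.mem_toFinset] at hb
      have := hx2 (Fin.append a b) hb
      simp only [Fin.append_snoc]
      exact this
    have hN' : N' ≤ (u + ε') * m ^ D := by linarith [(abs_le.1 hx1).2]
    have h1 : N' * (ε' * m ^ δ) ≤ (u + 1) * ε' * (m ^ D * m ^ δ) := by
      calc N' * (ε' * m ^ δ) ≤ ((u + ε') * m ^ D) * (ε' * m ^ δ) :=
            mul_le_mul_of_nonneg_right hN' (by positivity)
        _ ≤ ((u + 1) * m ^ D) * (ε' * m ^ δ) := by gcongr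
        _ = _ := by ring
    have h2 : |N' * (w * m ^ δ) - u * w * (m ^ D * m ^ δ)| ≤ w * ε' * (m ^ D * m ^ δ) := by
      have : N' * (w * m ^ δ) - u * w * (m ^ D * m ^ δ) = (N' - u * m ^ D) * (w * m ^ δ) := by ring
      rw [this, abs_mul, abs_of_nonneg (mul_nonneg hw hmδ)]
      calc _ ≤ (ε' * m ^ D) * (w * m ^ δ) :=
            mul_le_mul_of_nonneg_right hx1 (mul_nonneg hw hmδ)
        _ = _ := by ring
    have h3 : (u + 1 + w) * ε' * (m ^ D * m ^ δ) ≤ ε * (m ^ D * m ^ δ) :=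
      mul_le_mul_of_nonneg_right hε2 (by positivity)
    refine (abs_sub_le _ (N' * (w * m ^ δ)) _).trans ?_
    linarith

end Counting

/-- Of two sums with the same summands, each summand of a definite order of magnitude, the ratio
tends to the ratio of the leading coefficients. -/
lemma tendsto_sum_div_sum {Y ι : Type} {F : Filter Y} {n : Y → ℝ} (hn : Tendsto n F atTop)
    {N : ι → Y → ℝ} {D : ι → ℕ} {w : ι → ℝ} {s t : Finset ι} (hst : s ⊆ t) {m : ℕ}
    (hm : ∀ i ∈ t, D i ≤ m) (hex : ∃ i ∈ t, D i = m) (hw : ∀ i ∈ t, 0 < w i)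
    (hN : ∀ i ∈ t, Tendsto (fun y => N i y / n y ^ D i) F (nhds (w i))) :
    Tendsto (fun y => (∑ i ∈ s, N i y) / ∑ i ∈ t, N i y) F
      (nhds ((∑ i ∈ s with D i = m, w i) / ∑ i ∈ t with D i = m, w i)) := by
  have hpos : ∀ᶠ y in F, 0 < n y := hn.eventually_gt_atTop 0
  have hone : ∀ i ∈ t, Tendsto (fun y => N i y / n y ^ m) F
      (nhds (if D i = m then w i else 0)) := by
    intro i hi
    split_ifs with h
    · rw [← h]
      exact hN i hi
    · have hlt : m - D i ≠ 0 := by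
        have := hm i hi
        omega
      have h1 : Tendsto (fun y => (n y ^ (m - D i))⁻¹) F (nhds 0) :=
        ((tendsto_pow_atTop hlt).comp hn).inv_tendsto_atTop
      have h2 := (hN i hi).mul h1
      rw [mul_zero] at h2
      refine h2.congr' (hpos.mono fun y hy => ?_)
      beta_reduce
      have : n y ^ m = n y ^ D i * n y ^ (m - D i) := by
        rw [← pow_add, Nat.add_sub_cancel' (hm i hi)]
      rw [this]
      field_simp
  have hsum : ∀ u ⊆ t, Tendsto (fun y => (∑ i ∈ u, N i y) / n y ^ m) F
      (nhds (∑ i ∈ u with D i = m, w i)) := by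
    intro u hu
    rw [Finset.sum_filter]
    simp only [Finset.sum_div]
    exact tendsto_finsetSum _ fun i hi => hone i (hu hi)
  have hne : ∑ i ∈ t with D i = m, w i ≠ 0 := by
    refine (Finset.sum_pos (fun i hi => hw i (Finset.mem_filter.1 hi).1) ?_).ne'
    obtain ⟨i, hi, h⟩ := hex
    exact ⟨i, Finset.mem_filter.2 ⟨hi, h⟩⟩
  refine ((hsum s hst).div (hsum t subset_rfl) hne).congr' (hpos.mono fun y hy => ?_)
  exact div_div_div_cancel_right₀ (by positivity) _ _

/-! ### Critical numbers as ratios of sums over sets of types; proportions -/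

namespace LiftedBN

variable {σ : Type} {ar : σ → ℕ} [Fintype σ] (G : LiftedBN ar) {S : Set σ}

/-- Enumerate `t` with the members of `s` first, so that `s` becomes the initial segment of length
`l'`; `s` must be nonempty because `l' ≥ 1`. -/
lemma criticalA_of_finset {P : {k : ℕ} → Set (Atom ar k) → ℝ}
    (hlim : ∀ {k : ℕ} {p : Set (Atom ar k)}, IsDiag S p → G.IsLimitProb (lits S p) (P p))
    {d e m : ℕ} (hm : d + e ≤ m) {q : Set (Atom ar d)} (hq : IsDiag S q) (hPq : 0 < P q)
    {s t : Finset (Set (Atom ar (d + e)))} (hst : s ⊆ t) (hs : s.Nonempty)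
    (ht : ∀ p ∈ t, IsDiag S p ∧ pull (Fin.castAdd e) p = q ∧ 0 < P p) :
    G.CriticalA S m ((∑ p ∈ s, P p) / ∑ p ∈ t, P p) := by
  classical
  let f : Fin (s.card + (t \ s).card) → Set (Atom ar (d + e)) :=
    Fin.append (fun i => (s.equivFin.symm i).1) (fun i => ((t \ s).equivFin.symm i).1)
  have hft : ∀ i, f i ∈ t := fun i => by
    refine Fin.addCases (fun i => ?_) (fun i => ?_) i
    · simpa [f] using hst (s.equivFin.symm i).2
    · simpa [f] using (Finset.mem_sdiff.1 ((t \ s).equivFin.symm i).2).1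
  have hfinj : Function.Injective f := by
    rw [Fin.append_injective_iff]
    refine ⟨Subtype.val_injective.comp (Equiv.injective _),
      Subtype.val_injective.comp (Equiv.injective _), fun i j h => ?_⟩
    exact (Finset.mem_sdiff.1 ((t \ s).equivFin.symm j).2).2 (h ▸ (s.equivFin.symm i).2)
  have hsum1 : ∀ g : Set (Atom ar (d + e)) → ℝ,
      ∑ i : Fin s.card, g (s.equivFin.symm i).1 = ∑ p ∈ s, g p := fun g => by
    rw [← Finset.sum_coe_sort s]
    exact Equiv.sum_comp s.equivFin.symm fun p => g p.1
  have hsum2 : ∀ g : Set (Atom ar (d + e)) → ℝ,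
      ∑ i : Fin (t \ s).card, g ((t \ s).equivFin.symm i).1 = ∑ p ∈ t \ s, g p := fun g => by
    rw [← Finset.sum_coe_sort (t \ s)]
    exact Equiv.sum_comp (t \ s).equivFin.symm fun p => g p.1
  have htot : ∑ i, P (f i) / P q = (∑ p ∈ t, P p) / P q := by
    rw [← Finset.sum_div, Fin.sum_univ_add]
    simp only [f, Fin.append_left, Fin.append_right]
    rw [hsum1, hsum2, add_comm, Finset.sum_sdiff hst]
  have hpart : ∑ i : Fin (s.card + (t \ s).card) with i.val < s.card, P (f i) / P q =
      (∑ p ∈ s, P p) / P q := by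
    rw [← Finset.sum_div, Finset.sum_filter, Fin.sum_univ_add]
    simp only [f, Fin.append_left, Fin.append_right, Fin.val_castAdd, Fin.is_lt, if_true,
      Fin.val_natAdd, not_lt.2 (Nat.le_add_right _ _), if_false, Finset.sum_const_zero, add_zero]
    rw [hsum1]
  have htpos : 0 < ∑ p ∈ t, P p := Finset.sum_pos (fun p hp => (ht p hp).2.2) (hs.mono hst)
  refine ⟨d, e, lits S q, s.card + (t \ s).card, s.card, fun i => lits S (f i), P q,
    fun i => P (f i), hm, hs.card_pos, Nat.le_add_right _ _, isCompleteType_lits hq,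
    fun i => isCompleteType_lits (ht _ (hft i)).1, ?_, fun i => extends_lits (ht _ (hft i)).2.1,
    hlim hq, fun i => hlim (ht _ (hft i)).1, hPq.ne', ?_, ?_⟩
  · exact fun i j h => hfinj (lits_injective (ht _ (hft i)).1 (ht _ (hft j)).1 h)
  · rw [htot]
    positivity
  · rw [hpart, htot, div_div_div_cancel_right₀ hPq.ne']

end LiftedBN

lemma proportion_nonneg {B : Type} (X Y : Set B) : 0 ≤ proportion X Y := by
  unfold proportion
  positivity

lemma proportion_le_one {B : Type} [Finite B] (X Y : Set B) : proportion X Y ≤ 1 :=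
  div_le_one_of_le₀ (by exact_mod_cast Set.ncard_le_ncard Set.inter_subset_right) (by positivity)

lemma proportion_eq_zero_iff {B : Type} [Finite B] {X Y : Set B} (hY : Y.Nonempty) :
    proportion X Y = 0 ↔ X ∩ Y = ∅ := by
  have : (Y.ncard : ℝ) ≠ 0 := by
    exact_mod_cast ((Set.ncard_pos).2 hY).ne'
  unfold proportion
  rw [div_eq_zero_iff, or_iff_left this, Nat.cast_eq_zero, Set.ncard_eq_zero]

lemma proportion_eq_one_iff {B : Type} [Finite B] {X Y : Set B} (hY : Y.Nonempty) :
    proportion X Y = 1 ↔ Xᶜ ∩ Y = ∅ := by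
  have : (Y.ncard : ℝ) ≠ 0 := by
    exact_mod_cast ((Set.ncard_pos).2 hY).ne'
  unfold proportion
  rw [div_eq_one_iff_eq this, Nat.cast_inj]
  constructor
  · intro h
    have := Set.eq_of_subset_of_ncard_le (Set.inter_subset_right (s := X) (t := Y)) h.ge
    rw [← this]
    ext b
    simp only [Set.mem_inter_iff, Set.mem_compl_iff, Set.mem_empty_iff_false]
    tauto
  · intro h
    congr 1
    refine Set.inter_eq_right.2 fun b hb => ?_
    by_contra hX
    exact (h ▸ (⟨hX, hb⟩ : b ∈ Xᶜ ∩ Y) : b ∈ (∅ : Set B))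

/-! ### Asymptotics along the realizations of a fixed type -/

section Elimination

variable {σ : Type} {ar : σ → ℕ} {S : Set σ} {X : Type} {F : Filter X} {n : X → ℕ}
  {M : (x : X) → RelStr ar (Fin (n x))} {P : {k : ℕ} → Set (Atom ar k) → ℝ}

/-- The filter of likely events for a tuple that realizes the type `q`. -/
def typeFilter (S : Set σ) (F : Filter X) {n : X → ℕ} (M : (x : X) → RelStr ar (Fin (n x)))
    {d : ℕ} (q : Set (Atom ar d)) : Filter ((x : X) × (Fin d → Fin (n x))) :=
  comap Sigma.fst F ⊓ 𝓟 {y | diag S (M y.1) y.2 = q}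

lemma eventually_typeFilter {d : ℕ} {q : Set (Atom ar d)}
    {Q : ((x : X) × (Fin d → Fin (n x))) → Prop} :
    (∀ᶠ y in typeFilter S F M q, Q y) ↔
      ∀ᶠ x in F, ∀ a, diag S (M x) a = q → Q ⟨x, a⟩ := by
  unfold typeFilter
  rw [eventually_inf_principal, eventually_comap]
  refine eventually_congr (Eventually.of_forall fun x => ?_)
  constructor
  · exact fun h a ha => h ⟨x, a⟩ rfl ha
  · rintro h ⟨x', a⟩ rfl ha
    exact h a ha

lemma eventually_typeFilter_of_eventually {d : ℕ} {q : Set (Atom ar d)} {Q : X → Prop}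
    (h : ∀ᶠ x in F, Q x) : ∀ᶠ y in typeFilter S F M q, Q y.1 :=
  eventually_typeFilter.2 (h.mono fun _ hx _ _ => hx)

lemma exists_determined [Finite σ] {k : ℕ} {Q : (x : X) → (Fin k → Fin (n x)) → Prop}
    (h : ∀ q, ∃ c : Prop, ∀ᶠ y in typeFilter S F M q, (Q y.1 y.2 ↔ c)) :
    ∃ D : Set (Set (Atom ar k)), ∀ᶠ x in F, ∀ a, Q x a ↔ diag S (M x) a ∈ D := by
  choose c hc using h
  refine ⟨{q | c q}, ?_⟩
  have : ∀ᶠ x in F, ∀ q, ∀ a, diag S (M x) a = q → (Q x a ↔ c q) :=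
    eventually_all.2 fun q => eventually_typeFilter.1 (hc q)
  exact this.mono fun x hx a => hx _ a rfl

/-- The types of positive probability that extend `q` by `e` variables. -/
noncomputable def extTypes [Finite σ] (S : Set σ) (P : {k : ℕ} → Set (Atom ar k) → ℝ) {d : ℕ} (e : ℕ)
    (q : Set (Atom ar d)) : Finset (Set (Atom ar (d + e))) :=
  (Set.toFinite {p | IsDiag S p ∧ pull (Fin.castAdd e) p = q ∧ 0 < P p}).toFinset

lemma mem_extTypes [Finite σ] {d e : ℕ} {q : Set (Atom ar d)} {p : Set (Atom ar (d + e))} :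
    p ∈ extTypes S P e q ↔ IsDiag S p ∧ pull (Fin.castAdd e) p = q ∧ 0 < P p := by
  simp [extTypes]

lemma ncard_eq_sum_ncard_types {A : Type} [Finite A] {N : RelStr ar A} {d e : ℕ} (a : Fin d → A)
    {s : Finset (Set (Atom ar (d + e)))} {Z : Set (Fin e → A)}
    (hZ : ∀ b, b ∈ Z ↔ diag S N (Fin.append a b) ∈ s) :
    (Z.ncard : ℝ) = ∑ p ∈ s, ({b : Fin e → A | diag S N (Fin.append a b) = p}.ncard : ℝ) := by
  classical
  have := Fintype.ofFinite A
  rw [Set.ncard_eq_toFinset_card', Finset.card_eq_sum_card_fiberwise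
    (f := fun b => diag S N (Fin.append a b)) (t := s)]
  · push_cast
    refine Finset.sum_congr rfl fun p hp => ?_
    rw [Set.ncard_eq_toFinset_card']
    congr 2
    ext b
    simp only [Finset.mem_filter, Set.mem_toFinset, Set.mem_ofPred_eq, hZ]
    exact ⟨fun hb => hb.2, fun hb => ⟨hb ▸ hp, hb⟩⟩
  · intro b hb
    rw [Set.coe_toFinset] at hb
    exact (hZ b).1 hb

namespace Saturated

lemma tendsto_typeFilter (h : Saturated S F n M P) {d : ℕ} (q : Set (Atom ar d)) :
    Tendsto (fun y => (n y.1 : ℝ)) (typeFilter S F M q) atTop :=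
  tendsto_natCast_atTop_atTop.comp
    (h.tendsto.comp (tendsto_comap.mono_left inf_le_left))

/-- The property does not involve `y`: if it fails, `q` is realized with negligible probability, the
filter is trivial, and every claim about realizations of `q` holds vacuously. -/
lemma eventually_pos_and_isDiag (h : Saturated S F n M P) {d : ℕ} (q : Set (Atom ar d)) :
    ∀ᶠ _y in typeFilter S F M q, IsDiag S q ∧ 0 < P q := by
  rw [eventually_typeFilter]
  filter_upwards [h.ne_zero d, h.tendsto.eventually_gt_atTop 0] with x hx hn a ha
  have : Nonempty (Fin (n x)) := ⟨⟨0, hn⟩⟩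
  subst ha
  exact ⟨isDiag_diag _ _ _, lt_of_le_of_ne (h.nonneg _) (hx a).symm⟩

lemma eventually_mem_extTypes [Finite σ] (h : Saturated S F n M P)
    {d : ℕ} (e : ℕ) (q : Set (Atom ar d)) :
    ∀ᶠ y in typeFilter S F M q, ∀ b : Fin e → Fin (n y.1),
      diag S (M y.1) (Fin.append y.2 b) ∈ extTypes S P e q := by
  rw [eventually_typeFilter]
  filter_upwards [h.ne_zero (d + e), h.tendsto.eventually_gt_atTop 0] with x hx hn a ha b
  have : Nonempty (Fin (n x)) := ⟨⟨0, hn⟩⟩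
  refine mem_extTypes.2 ⟨isDiag_diag _ _ _, ?_, lt_of_le_of_ne (h.nonneg _) (hx _).symm⟩
  rw [pull_diag, ← ha]
  congr 1
  funext i
  simp

lemma tendsto_count [Finite σ] (h : Saturated S F n M P)
    {d e : ℕ} {q : Set (Atom ar d)} {p : Set (Atom ar (d + e))}
    (hp : p ∈ extTypes S P e q) :
    Tendsto (fun y : (x : X) × (Fin d → Fin (n x)) =>
      ({b : Fin e → Fin (n y.1) | diag S (M y.1) (Fin.append y.2 b) = p}.ncard : ℝ) /
        (n y.1 : ℝ) ^ extDim e p) (typeFilter S F M q) (nhds (P p / P q)) := by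
  obtain ⟨hp1, rfl, _⟩ := mem_extTypes.1 hp
  rw [Metric.tendsto_nhds]
  intro ε hε
  rw [eventually_typeFilter]
  filter_upwards [h.count e p hp1 (ε / 2) (half_pos hε), h.tendsto.eventually_gt_atTop 0]
    with x hx hn a ha
  have hpos : (0 : ℝ) < (n x : ℝ) ^ extDim e p := by positivity
  rw [Real.dist_eq, div_sub' hpos.ne', abs_div, abs_of_pos hpos, div_lt_iff₀ hpos, mul_comm _ (P _ / _)]
  refine (hx a ha).trans_lt ?_
  exact mul_lt_mul_of_pos_right (half_lt_self hε) hpos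

/-- A type of positive probability extending `q` is realized, since its normalized count has the
positive limit `P p / P q`; a type of probability zero is not realized at all. -/
lemma eventually_nonempty_iff [Finite σ] (h : Saturated S F n M P)
    {d : ℕ} (e : ℕ) (q : Set (Atom ar d))
    (T : Set (Set (Atom ar (d + e)))) :
    ∀ᶠ y in typeFilter S F M q,
      ((∃ b : Fin e → Fin (n y.1), diag S (M y.1) (Fin.append y.2 b) ∈ T) ↔
        ∃ p ∈ extTypes S P e q, p ∈ T) := by
  have hreal : ∀ᶠ y in typeFilter S F M q, ∀ p, p ∈ extTypes S P e q →
      ∃ b : Fin e → Fin (n y.1), diag S (M y.1) (Fin.append y.2 b) = p := by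
    rw [eventually_all]
    intro p
    by_cases hp : p ∈ extTypes S P e q
    · by_cases hq : 0 < P q
      · have hpos : 0 < P p / P q := div_pos (mem_extTypes.1 hp).2.2 hq
        filter_upwards [(h.tendsto_count hp).eventually_const_lt hpos] with y hy _
        by_contra hcon
        push Not at hcon
        rw [Set.eq_empty_of_forall_notMem (s := {b : Fin e → Fin (n y.1) |
          diag S (M y.1) (Fin.append y.2 b) = p}) hcon] at hy
        simp at hy
      · exact (h.eventually_pos_and_isDiag q).mono fun y hy => absurd hy.2 hq
    · exact Eventually.of_forall fun y hp' => absurd hp' hp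
  filter_upwards [hreal, h.eventually_mem_extTypes e q] with y hy1 hy2
  constructor
  · rintro ⟨b, hb⟩
    exact ⟨_, hy2 b, hb⟩
  · rintro ⟨p, hp, hpT⟩
    obtain ⟨b, rfl⟩ := hy1 p hp
    exact ⟨b, hpT⟩

end Saturated

end Elimination

/-- A threshold `r ≠ 1` that is no difference of numbers in `C` is no difference of two numbers of
which each is `0` or in `C`, and which have complements with the same property. -/
lemma threshold_ne_sub {C : Set ℝ} {r u v : ℝ} (hr : 0 ≤ r) (hr1 : r ≠ 1)
    (hC : ∀ a ∈ C, ∀ b ∈ C, r ≠ a - b) (h1 : (1 : ℝ) ∈ C) (hu : u = 0 ∨ u ∈ C)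
    (hu' : u = 1 ∨ 1 - u ∈ C) (hv : v = 0 ∨ v ∈ C) (hv0 : 0 ≤ v) : r ≠ u - v := by
  intro h
  have hr0 : r ≠ 0 := by simpa using hC 1 h1 1 h1
  -- `0` need not belong to `C`. For `v = 0` one writes `u = 1 - (1 - u)`; for `u = 0` the
  -- difference is `-v ≤ 0`, which is excluded by `0 ≤ r` and `r ≠ 0`.
  rcases hv with rfl | hv
  · rw [sub_zero] at h
    rcases hu' with rfl | hu'
    · exact hr1 h
    · exact hC 1 h1 _ hu' (by linarith)
  · rcases hu with rfl | hu
    · exact hr0 (by linarith)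
    · exact hC u hu v hv h

/-- In a comparison of limits in which equality is excluded, the limits decide. -/
lemma eventually_ge_iff {Y : Type} {F : Filter Y} {f g : Y → ℝ} {u v : ℝ}
    (hf : Tendsto f F (nhds u)) (hg : Tendsto g F (nhds v)) (hne : u ≠ v) :
    ∀ᶠ y in F, (f y ≥ g y ↔ u ≥ v) := by
  rcases lt_or_gt_of_ne hne with h | h
  · filter_upwards [hf.eventually_lt hg h] with y hy
    exact iff_of_false (not_le.2 hy) (not_le.2 h)
  · filter_upwards [hg.eventually_lt hf h] with y hy
    exact iff_of_true hy.le h.le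

/-! ### Elimination of quantifiers in saturated structures -/

section Elimination

variable {σ : Type} {ar : σ → ℕ} [Fintype σ] {G : LiftedBN ar} {S : Set σ} {X : Type} {F : Filter X}
  {n : X → ℕ} {M : (x : X) → RelStr ar (Fin (n x))} {P : {k : ℕ} → Set (Atom ar k) → ℝ}

namespace Saturated

/-- Proportions converge, and the limit is a critical number or `0`. -/
lemma exists_tendsto_proportion (h : Saturated S F n M P)
    (hlim : ∀ {k : ℕ} {p : Set (Atom ar k)}, IsDiag S p → G.IsLimitProb (lits S p) (P p))
    {d e m : ℕ} (hm : d + e ≤ m) {q : Set (Atom ar d)} (hq : IsDiag S q) (hPq : 0 < P q)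
    (T U : Set (Set (Atom ar (d + e)))) (hU : ∃ p ∈ extTypes S P e q, p ∈ U) :
    ∃ u : ℝ, Tendsto (fun y : (x : X) × (Fin d → Fin (n x)) => proportion
        {b : Fin e → Fin (n y.1) | diag S (M y.1) (Fin.append y.2 b) ∈ T}
        {b : Fin e → Fin (n y.1) | diag S (M y.1) (Fin.append y.2 b) ∈ U})
      (typeFilter S F M q) (nhds u) ∧ 0 ≤ u ∧ (u = 0 ∨ G.CriticalA S m u) ∧
      (u = 1 ∨ G.CriticalA S m (1 - u)) ∧ G.CriticalA S m 1 := by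
  classical
  set t := (extTypes S P e q).filter fun p => p ∈ U with ht
  set s := t.filter fun p => p ∈ T with hs
  have hst : s ⊆ t := Finset.filter_subset _ _
  have htne : t.Nonempty := by
    obtain ⟨p, hp, hpU⟩ := hU
    exact ⟨p, Finset.mem_filter.2 ⟨hp, hpU⟩⟩
  have htmem : ∀ p ∈ t, p ∈ extTypes S P e q := fun p hp => (Finset.mem_filter.1 hp).1
  -- Only types of the largest dimension `D` contribute to the limit of the proportion.
  obtain ⟨p₀, hp₀, hmax⟩ := t.exists_max_image (extDim e) htne
  set D := extDim e p₀
  have hconv := tendsto_sum_div_sum (F := typeFilter S F M q) (h.tendsto_typeFilter q)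
    (N := fun p y => ({b : Fin e → Fin (n y.1) |
      diag S (M y.1) (Fin.append y.2 b) = p}.ncard : ℝ))
    (D := extDim e) (w := fun p => P p / P q) hst hmax ⟨p₀, hp₀, rfl⟩
    (fun p hp => div_pos (mem_extTypes.1 (htmem p hp)).2.2 hPq)
    (fun p hp => h.tendsto_count (htmem p hp))
  set t' := t.filter fun p => extDim e p = D with ht'
  set s' := s.filter fun p => extDim e p = D with hs'
  have hst' : s' ⊆ t' := Finset.filter_subset_filter _ hst
  have ht'ne : t'.Nonempty := ⟨p₀, Finset.mem_filter.2 ⟨hp₀, rfl⟩⟩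
  have ht'mem : ∀ p ∈ t', IsDiag S p ∧ pull (Fin.castAdd e) p = q ∧ 0 < P p :=
    fun p hp => mem_extTypes.1 (htmem p (Finset.mem_filter.1 hp).1)
  have htpos : 0 < ∑ p ∈ t', P p := Finset.sum_pos (fun p hp => (ht'mem p hp).2.2) ht'ne
  rw [← Finset.sum_div, ← Finset.sum_div, div_div_div_cancel_right₀ hPq.ne'] at hconv
  have hcrit : ∀ r ⊆ t', r.Nonempty → G.CriticalA S m ((∑ p ∈ r, P p) / ∑ p ∈ t', P p) :=
    fun r hr hne => G.criticalA_of_finset hlim hm hq hPq hr hne ht'mem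
  refine ⟨_, hconv.congr' ?_, ?_, ?_, ?_, ?_⟩
  · filter_upwards [h.eventually_mem_extTypes e q] with y hy
    unfold proportion
    congr 1
    · symm
      refine ncard_eq_sum_ncard_types y.2 fun b => ?_
      simp only [hs, ht, Finset.mem_filter, hy b, true_and]
      exact and_comm
    · symm
      refine ncard_eq_sum_ncard_types y.2 fun b => ?_
      simp only [ht, Finset.mem_filter, hy b, true_and]
      rfl
  · exact div_nonneg (Finset.sum_nonneg fun p _ => h.nonneg p) htpos.le
  · rcases s'.eq_empty_or_nonempty with h0 | h0
    · left
      rw [h0, Finset.sum_empty, zero_div]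
    · exact Or.inr (hcrit s' hst' h0)
  · rcases (t' \ s').eq_empty_or_nonempty with h0 | h0
    · left
      rw [Finset.Subset.antisymm hst' (Finset.sdiff_eq_empty_iff_subset.1 h0)]
      exact div_self htpos.ne'
    -- The complementary set of types, `t' \ s'`, realizes the number `1 - u`.
    · right
      have := hcrit (t' \ s') Finset.sdiff_subset h0
      have hsum : ∑ p ∈ t' \ s', P p = ∑ p ∈ t', P p - ∑ p ∈ s', P p :=
        eq_sub_of_add_eq (Finset.sum_sdiff hst')
      rwa [hsum, ← one_sub_div htpos.ne'] at this
  · have := hcrit t' subset_rfl ht'ne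
    rwa [div_self htpos.ne'] at this

/-- In a saturated random structure, conditional probability quantifiers with noncritical
thresholds can be eliminated. -/
lemma exists_determined_cond (h : Saturated S F n M P)
    (hlim : ∀ {k : ℕ} {p : Set (Atom ar k)}, IsDiag S p → G.IsLimitProb (lits S p) (P p))
    {d e m : ℕ} (hm : d + e ≤ m) {r : ℝ} (hr : 0 ≤ r)
    (hC : ∀ u, G.CriticalA S m u → ∀ v, G.CriticalA S m v → r ≠ u - v)
    (T U V W : Set (Set (Atom ar (d + e)))) (q : Set (Atom ar d)) :
    ∃ c₁ c₂ c₃ c₄ : Prop, ∀ᶠ y : (x : X) × (Fin d → Fin (n x)) in typeFilter S F M q,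
      let Z (T : Set (Set (Atom ar (d + e)))) :=
        {b : Fin e → Fin (n y.1) | diag S (M y.1) (Fin.append y.2 b) ∈ T}
      ((Z U).Nonempty ↔ c₁) ∧ ((Z W).Nonempty ↔ c₂) ∧
      ((Z U).Nonempty → (Z W).Nonempty →
        ((r + proportion (Z T) (Z U) ≥ proportion (Z V) (Z W) ↔ c₃) ∧
        (proportion (Z T) (Z U) ≥ proportion (Z V) (Z W) + r ↔ c₄))) := by
  by_cases hq : IsDiag S q ∧ 0 < P q
  swap
  · exact ⟨True, True, True, True,
      (h.eventually_pos_and_isDiag q).mono fun y hy => absurd hy hq⟩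
  by_cases hU : ∃ p ∈ extTypes S P e q, p ∈ U
  swap
  · refine ⟨∃ p ∈ extTypes S P e q, p ∈ U, ∃ p ∈ extTypes S P e q, p ∈ W, True, True, ?_⟩
    filter_upwards [h.eventually_nonempty_iff e q U, h.eventually_nonempty_iff e q W] with y h1 h2
    exact ⟨h1, h2, fun hne => absurd (h1.1 hne) hU⟩
  by_cases hW : ∃ p ∈ extTypes S P e q, p ∈ W
  swap
  · refine ⟨∃ p ∈ extTypes S P e q, p ∈ U, ∃ p ∈ extTypes S P e q, p ∈ W, True, True, ?_⟩
    filter_upwards [h.eventually_nonempty_iff e q U, h.eventually_nonempty_iff e q W] with y h1 h2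
    exact ⟨h1, h2, fun _ hne => absurd (h2.1 hne) hW⟩
  obtain ⟨u, hu, hu0, hu1, hu2, h1⟩ :=
    h.exists_tendsto_proportion hlim hm hq.1 hq.2 T U hU
  obtain ⟨v, hv, hv0, hv1, hv2, -⟩ :=
    h.exists_tendsto_proportion hlim hm hq.1 hq.2 V W hW
  -- The threshold `1` can tie with the limits `1` and `0`, as `0` need not be critical of the first
  -- kind. It is treated exactly: proportions lie in `[0, 1]`, so the first inequality always holds
  -- and the second says that one proportion is `1` and the other `0`, that is, that `Z Tᶜ ∩ Z U`
  -- and `Z V ∩ Z W` are empty.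
  by_cases hr1 : r = 1
  · refine ⟨∃ p ∈ extTypes S P e q, p ∈ U, ∃ p ∈ extTypes S P e q, p ∈ W, True,
      (¬ ∃ p ∈ extTypes S P e q, p ∈ Tᶜ ∩ U) ∧
      ¬ ∃ p ∈ extTypes S P e q, p ∈ V ∩ W, ?_⟩
    filter_upwards [h.eventually_nonempty_iff e q U, h.eventually_nonempty_iff e q W,
      h.eventually_nonempty_iff e q (Tᶜ ∩ U), h.eventually_nonempty_iff e q (V ∩ W)]
      with y y1 y2 y3 y4
    intro Z
    refine ⟨y1, y2, fun hne hne' => ?_⟩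
    have b1 := proportion_nonneg (Z T) (Z U)
    have b2 := proportion_le_one (Z T) (Z U)
    have b3 := proportion_nonneg (Z V) (Z W)
    have b4 := proportion_le_one (Z V) (Z W)
    refine ⟨iff_true_intro (by linarith), ?_⟩
    rw [← y3, ← y4]
    have : proportion (Z T) (Z U) ≥ proportion (Z V) (Z W) + r ↔
        proportion (Z T) (Z U) = 1 ∧ proportion (Z V) (Z W) = 0 := by
      constructor
      · exact fun hge => ⟨by linarith, by linarith⟩
      · rintro ⟨e1, e2⟩
        linarith
    rw [this, proportion_eq_one_iff hne, proportion_eq_zero_iff hne', ← Set.not_nonempty_iff_eq_empty,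
      ← Set.not_nonempty_iff_eq_empty]
    rfl
  · have hne1 : r ≠ v - u := threshold_ne_sub hr hr1 hC h1 hv1 hv2 hu1 hu0
    have hne2 : r ≠ u - v := threshold_ne_sub hr hr1 hC h1 hu1 hu2 hv1 hv0
    refine ⟨∃ p ∈ extTypes S P e q, p ∈ U, ∃ p ∈ extTypes S P e q, p ∈ W, r + u ≥ v, u ≥ v + r, ?_⟩
    filter_upwards [h.eventually_nonempty_iff e q U, h.eventually_nonempty_iff e q W,
      eventually_ge_iff (hu.const_add r) hv (fun he => hne1 (by linarith)),
      eventually_ge_iff hu (hv.add_const r) (fun he => hne2 (by linarith))] with y y1 y2 y3 y4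
    exact ⟨y1, y2, fun _ _ => ⟨y3, y4⟩⟩

/-- In a saturated random structure, every noncritical formula depends with high probability only
on the atomic types. -/
theorem exists_determined_formula (h : Saturated S F n M P)
    (hlim : ∀ {k : ℕ} {p : Set (Atom ar k)}, IsDiag S p → G.IsLimitProb (lits S p) (P p)) {m : ℕ}
    {k : ℕ} (φ : CPL ar k) (hφ : φ.Over S) (hm : k + φ.qr ≤ m)
    (hC : ∀ r ∈ φ.thresholds, ∀ u, G.CriticalA S m u → ∀ v, G.CriticalA S m v → r ≠ u - v) :
    ∃ D : Set (Set (Atom ar k)), ∀ᶠ x in F, ∀ a, φ.Holds (M x) a ↔ diag S (M x) a ∈ D := by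
  -- A single `m` serves all subformulas: entering a quantifier raises the number of variables by no
  -- more than the quantifier rank drops.
  induction φ with
  | atom t =>
    refine ⟨{p | t ∈ p}, Eventually.of_forall fun x a => ?_⟩
    exact atom_holds_iff_mem_diag hφ
  | neg φ ih =>
    obtain ⟨D, hD⟩ := ih hφ hm hC
    refine ⟨Dᶜ, hD.mono fun x hx a => ?_⟩
    simp only [CPL.Holds, hx a, Set.mem_compl_iff]
  | and φ ψ ih1 ih2 =>
    simp only [CPL.qr] at hm
    obtain ⟨D, hD⟩ := ih1 hφ.1 (by omega) fun r hr => hC r (Or.inl hr)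
    obtain ⟨E, hE⟩ := ih2 hφ.2 (by omega) fun r hr => hC r (Or.inr hr)
    refine ⟨{p | p ∈ D ∧ p ∈ E}, (hD.and hE).mono fun x hx a => ?_⟩
    simp only [CPL.Holds, hx.1 a, hx.2 a, Set.mem_ofPred_eq]
  | or φ ψ ih1 ih2 =>
    simp only [CPL.qr] at hm
    obtain ⟨D, hD⟩ := ih1 hφ.1 (by omega) fun r hr => hC r (Or.inl hr)
    obtain ⟨E, hE⟩ := ih2 hφ.2 (by omega) fun r hr => hC r (Or.inr hr)
    refine ⟨{p | p ∈ D ∨ p ∈ E}, (hD.and hE).mono fun x hx a => ?_⟩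
    simp only [CPL.Holds, hx.1 a, hx.2 a, Set.mem_ofPred_eq]
  | imp φ ψ ih1 ih2 =>
    simp only [CPL.qr] at hm
    obtain ⟨D, hD⟩ := ih1 hφ.1 (by omega) fun r hr => hC r (Or.inl hr)
    obtain ⟨E, hE⟩ := ih2 hφ.2 (by omega) fun r hr => hC r (Or.inr hr)
    refine ⟨{p | p ∈ D → p ∈ E}, (hD.and hE).mono fun x hx a => ?_⟩
    simp only [CPL.Holds, hx.1 a, hx.2 a, Set.mem_ofPred_eq]
  | iff φ ψ ih1 ih2 =>
    simp only [CPL.qr] at hm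
    obtain ⟨D, hD⟩ := ih1 hφ.1 (by omega) fun r hr => hC r (Or.inl hr)
    obtain ⟨E, hE⟩ := ih2 hφ.2 (by omega) fun r hr => hC r (Or.inr hr)
    refine ⟨{p | p ∈ D ↔ p ∈ E}, (hD.and hE).mono fun x hx a => ?_⟩
    simp only [CPL.Holds, hx.1 a, hx.2 a, Set.mem_ofPred_eq]
  | ex φ ih =>
    simp only [CPL.qr] at hm
    obtain ⟨D, hD⟩ := ih hφ (by omega) hC
    refine exists_determined fun q => ⟨∃ p ∈ extTypes S P 1 q, p ∈ D, ?_⟩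
    filter_upwards [eventually_typeFilter_of_eventually hD, h.eventually_nonempty_iff 1 q D]
      with y hy1 hy2
    rw [← hy2]
    simp only [CPL.Holds, hy1]
    constructor
    · rintro ⟨b, hb⟩
      refine ⟨fun _ => b, ?_⟩
      rwa [Fin.append_right_eq_snoc]
    · rintro ⟨b, hb⟩
      refine ⟨b 0, ?_⟩
      rwa [Fin.append_right_eq_snoc] at hb
  | condL e r φ ψ θ τ ih1 ih2 ih3 ih4 =>
    simp only [CPL.qr] at hm
    obtain ⟨T, hT⟩ := ih1 hφ.1 (by omega) fun r hr => hC r (by simp [CPL.thresholds, hr])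
    obtain ⟨U, hU⟩ := ih2 hφ.2.1 (by omega) fun r hr => hC r (by simp [CPL.thresholds, hr])
    obtain ⟨V, hV⟩ := ih3 hφ.2.2.1 (by omega) fun r hr => hC r (by simp [CPL.thresholds, hr])
    obtain ⟨W, hW⟩ := ih4 hφ.2.2.2 (by omega) fun r hr => hC r (by simp [CPL.thresholds, hr])
    refine exists_determined fun q => ?_
    obtain ⟨c₁, c₂, c₃, c₄, hc⟩ := h.exists_determined_cond hlim (e := e) (m := m) (by omega)
      r.2 (hC r (by simp [CPL.thresholds])) T U V W q
    refine ⟨c₁ ∧ c₂ ∧ c₃, ?_⟩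
    filter_upwards [eventually_typeFilter_of_eventually (hT.and (hU.and (hV.and hW))), hc]
      with y hy hyc
    simp only [CPL.Holds, hy.1, hy.2.1, hy.2.2.1, hy.2.2.2]
    dsimp only at hyc
    rw [← hyc.1, ← hyc.2.1]
    exact and_congr_right fun h1 => and_congr_right fun h2 => (hyc.2.2 h1 h2).1
  | condR e r φ ψ θ τ ih1 ih2 ih3 ih4 =>
    simp only [CPL.qr] at hm
    obtain ⟨T, hT⟩ := ih1 hφ.1 (by omega) fun r hr => hC r (by simp [CPL.thresholds, hr])
    obtain ⟨U, hU⟩ := ih2 hφ.2.1 (by omega) fun r hr => hC r (by simp [CPL.thresholds, hr])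
    obtain ⟨V, hV⟩ := ih3 hφ.2.2.1 (by omega) fun r hr => hC r (by simp [CPL.thresholds, hr])
    obtain ⟨W, hW⟩ := ih4 hφ.2.2.2 (by omega) fun r hr => hC r (by simp [CPL.thresholds, hr])
    refine exists_determined fun q => ?_
    obtain ⟨c₁, c₂, c₃, c₄, hc⟩ := h.exists_determined_cond hlim (e := e) (m := m) (by omega)
      r.2 (hC r (by simp [CPL.thresholds])) T U V W q
    refine ⟨c₁ ∧ c₂ ∧ c₄, ?_⟩
    filter_upwards [eventually_typeFilter_of_eventually (hT.and (hU.and (hV.and hW))), hc]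
      with y hy hyc
    simp only [CPL.Holds, hy.1, hy.2.1, hy.2.2.1, hy.2.2.2]
    dsimp only at hyc
    rw [← hyc.1, ← hyc.2.1]
    exact and_congr_right fun h1 => and_congr_right fun h2 => (hyc.2.2 h1 h2).2

end Saturated

end Elimination

/-! ### Induction along the network and the main theorem -/

namespace LiftedBN

variable {σ : Type} {ar : σ → ℕ} [Fintype σ] (G : LiftedBN ar) {S : Set σ}

/-- By `limP_eq_mul` the quotient `P p / P q` is `extP` whenever `q` has nonzero probability, which
with high probability holds for all realized types. -/
lemma saturated_localSelector (hS : ∀ R ∈ S, G.ancestors R ⊆ S)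
    (c : (R : σ) → Set (Atom ar (ar R)) → Fin (G.ν R)) :
    Saturated S G.whp Sigma.fst (fun x => (G.localSelector S c).str x.2) (G.limP S c) where
  tendsto := G.tendsto_fst_whp
  nonneg := G.limP_nonneg S c
  eq_zero p hp := by rw [limP_eq_mul, hp, zero_mul]
  ne_zero := G.eventually_limP_ne_zero c hS
  ext {k p} hp ε hε := by
    filter_upwards [G.eventually_count_extensions c hS hp hε, G.eventually_limP_ne_zero c hS k]
      with x hx hx0 a ha
    have h0 := hx0 a
    rw [ha] at h0
    rw [limP_eq_mul, mul_div_cancel_left₀ _ h0]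
    exact hx a ha

/-- Almost sure elimination of quantifiers for formulas over a set of symbols that is closed under
parents. -/
theorem exists_determined_of_noncritical
    (hG : ∀ (R : σ) (i : Fin (G.ν R)), G.Noncritical (G.ancestors R) (G.χ R i)) :
    ∀ (S : Set σ), (∀ R ∈ S, G.ancestors R ⊆ S) → ∀ (k : ℕ) (φ : CPL ar k), φ.Over S →
      G.Noncritical S φ → ∃ D : Set (Set (Atom ar k)), ∀ᶠ x in G.whp, ∀ a,
        φ.Holds (G.selector.str x.2) a ↔ diag S (G.selector.str x.2) a ∈ D := by
  classical
  intro S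
  induction hN : S.ncard using Nat.strong_induction_on generalizing S with
  | _ N ih =>
  intro hS k φ hφ hcrit
  subst hN
  have hχ : ∀ R ∈ S, ∀ i, ∃ D : Set (Set (Atom ar (ar R))), ∀ᶠ x in G.whp, ∀ a,
      (G.χ R i).Holds (G.selector.str x.2) a ↔
        diag (G.ancestors R) (G.selector.str x.2) a ∈ D := by
    intro R hR i
    -- By acyclicity `R` is not its own ancestor, so its ancestors form a proper subset of `S`.
    refine ih _ (Set.ncard_lt_ncard ?_) (G.ancestors R) rfl
      (fun Q hQ => G.ancestors_subset hQ) _ _ (G.χ_over_ancestors R i) (hG R i)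
    exact ⟨hS R hR, fun hsub => G.acyclic R (hsub hR)⟩
  choose! D hD using hχ
  -- For a realized type the sets `D R i` single out, with high probability, exactly the index of
  -- the aggregation formula that holds; on other types the choice is immaterial.
  let c : (R : σ) → Set (Atom ar (ar R)) → Fin (G.ν R) := fun R p =>
    if h : ∃ i, p ∈ D R i then h.choose else ⟨0, G.ν_pos R⟩
  have hc : ∀ R ∈ S, ∀ᶠ x in G.whp, ∀ a, G.selector.sel x.1 R (G.selector.str x.2) a =
      c R (diag (G.ancestors R) (G.selector.str x.2) a) := by
    intro R hR
    filter_upwards [eventually_all.2 (hD R hR), G.tendsto_fst_whp.eventually_gt_atTop 0]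
      with x hx hn a
    have hiff : ∀ i, diag (G.ancestors R) (G.selector.str x.2) a ∈ D R i ↔
        i = G.selector.sel x.1 R (G.selector.str x.2) a := fun i => by
      rw [← hx i a]
      exact G.holds_iff_eq_selector hn R _ a i
    have hex : ∃ i, diag (G.ancestors R) (G.selector.str x.2) a ∈ D R i := ⟨_, (hiff _).2 rfl⟩
    simp only [c, hex, dite_true]
    exact ((hiff _).1 hex.choose_spec).symm
  have heq := G.eventually_str_eq c hc
  obtain ⟨E, hE⟩ := (G.saturated_localSelector hS c).exists_determined_formula
    (G.isLimitProb_lits c hS heq) φ hφ le_rfl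
    fun r hr u hu v hv => hcrit r hr u v (Or.inl hu) (Or.inl hv)
  refine ⟨E, ?_⟩
  filter_upwards [heq, hE] with x hx hxE
  rw [hx]
  exact hxE

end LiftedBN

theorem mainTheorem1 {σ : Type} [Fintype σ] (ar : σ → ℕ) (G : LiftedBN ar)
    (hG : ∀ (R : σ) (i : Fin (G.ν R)), G.Noncritical (G.ancestors R) (G.χ R i))
    (k : ℕ) (φ : CPL ar k) (hφ : G.Noncritical Set.univ φ) :
    ∃ φs : CPL ar k, φs.QuantifierFree ∧ ∃ c : ℝ, 0 < c ∧
      ∀ᶠ n : ℕ in Filter.atTop,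
        G.prob n {M | ∀ a : Fin k → Fin n, φ.Holds M a ↔ φs.Holds M a} ≥
          1 - Real.exp (-c * (n : ℝ)) := by
  obtain ⟨D, hD⟩ := G.exists_determined_of_noncritical hG Set.univ (fun _ _ => Set.subset_univ _)
    k φ φ.over_univ hφ
  obtain ⟨φs, hqf, hφs⟩ := exists_quantifierFree D
  obtain ⟨c, hc, h⟩ := eventually_expSmallFilter.1 hD
  refine ⟨φs, hqf, c, hc, ?_⟩
  filter_upwards [h, eventually_gt_atTop 0] with n hn hn0
  rw [G.prob_eq hn0]
  have hcompl := probReal_add_probReal_compl (μ := G.bitMeasure n) (G.measurableSet_bits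
    {B | ∀ a, φ.Holds (G.selector.str B) a ↔ diag Set.univ (G.selector.str B) a ∈ D})
  simp only [Set.mem_ofPred_eq, hφs]
  have : {B : G.Bits n | ∀ a, φ.Holds (G.selector.str B) a ↔
      diag Set.univ (G.selector.str B) a ∈ D}ᶜ = {B | ¬ ∀ a, φ.Holds (G.selector.str B) a ↔
      diag Set.univ (G.selector.str B) a ∈ D} := rfl
  rw [this] at hcompl
  linarith
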